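/- Let $n,N\ge 0$, let $S=\mathbb{C}[x_0,\dots,x_n,y_1,\dots,y_N]$ be the homogeneous coordinate ring of $\mathbb{P}^{n+N}$ with its standard grading, let $I=(y_1,\dots,y_N)\subseteq S$ be the ideal of the linear subspace $X=\mathbb{P}^n\subseteq\mathbb{P}^{n+N}$, and let $R=S/I\cong\mathbb{C}[x_0,\dots,x_n]$. For a finitely generated $\mathbb{Z}$-graded module $P$ over a standard graded polynomial ring $A$ over $\mathbb{C}$, let $\beta_{i,j}^A(P)$ be the graded Betti number, that is, the number of generators of degree $j$ of the $i$-th free module in a minimal graded free resolution of $P$ over $A$. Say that $P$ has maximal degree sequence $(t_0,\dots,t_r)$ if $t_i=\max\{j : \beta_{i,j}^A(P)\ne 0\}$ for $0\le i\le r$ and $\beta_{i,j}^A(P)=0$ for all $i>r$ and all $j$. Put $\operatorname{reg}P=\max\{j-i : \beta_{i,j}^A(P)\neq 0\}$. Let $M$ be a finitely generated $\mathbb{Z}$-graded $R$-module, generated by its homogeneous elements of positive degree, with strictly increasing maximal degree sequence $(t_0,t_1,\dots,t_r)$ over $R$, where $r\le n+1$. Let $k$ be the minimum degree of a minimal generator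 of $M$, that is, $k=\min\{j:\beta^R_{0,j}(M)\ne 0\}$. Suppose that $$\sum_{j\in\mathbb{Z}}\beta_{0,j}^R(M)\le\binom{k+N-1}{k}.$$ Then there is a homogeneous ideal $J_M\subseteq S$ such that 1. $J_M$ is supported on $X$, that is, $\sqrt{J_M}=I$; 2. $J_M\subseteq I^k$, and moreover $I^{k+1}\subseteq J_M$ if $r\ge 1$ or $t_0=k$ (so the second inclusion is not asserted only when $M$ is free with generators in different degrees); 3. as a graded $S$-module, $J_M$ has maximal degree sequence $(t_1,t_2,\dots,t_r,\,t_r+1,t_r+2,\dots,t_r+N)$. In particular, $\operatorname{reg}J_M=\operatorname{reg}M+1$, where $\operatorname{reg} J_M$ is taken over $S$ and $\operatorname{reg} M$ over $R$. -/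

import Mathlib

open MvPolynomial

/-- The standard grading of the polynomial ring `ℂ[x_s : s ∈ σ]`, every variable having degree one,
indexed by `ℤ` (so that the pieces of negative degree are zero). -/
abbrev stdGrading (σ : Type) : ℤ → Submodule ℂ (MvPolynomial σ ℂ) :=
  weightedHomogeneousSubmodule ℂ (fun _ : σ => (1 : ℤ))

noncomputable instance stdGradedAlgebra (σ : Type) : GradedAlgebra (stdGrading σ) :=
  weightedGradedAlgebra ℂ (fun _ : σ => (1 : ℤ))

/-- A minimal graded free resolution
`⋯ → F₂ → F₁ → F₀ → M → 0` of a graded module `M = ⨁ⱼ 𝓜 j` over the standard graded polynomial ring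
`A = ℂ[x_s : s ∈ σ]`.  Here `Fᵢ = ⨁ₐ A(-deg i a)` is free on finitely many generators, the `a`-th of
which is placed in degree `deg i a`. -/
structure MinimalGradedFreeResolution (σ : Type) {M : Type*} [AddCommGroup M]
    [Module (MvPolynomial σ ℂ) M] (𝓜 : ℤ → AddSubgroup M) where
  /-- the rank of `Fᵢ` -/
  rank : ℕ → ℕ
  /-- the degrees of the generators of `Fᵢ` -/
  deg : (i : ℕ) → Fin (rank i) → ℤ
  /-- the differential `Fᵢ₊₁ → Fᵢ` -/
  d : (i : ℕ) →
    (Fin (rank (i + 1)) → MvPolynomial σ ℂ) →ₗ[MvPolynomial σ ℂ] (Fin (rank i) → MvPolynomial σ ℂ)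
  /-- the augmentation `F₀ → M` -/
  ε : (Fin (rank 0) → MvPolynomial σ ℂ) →ₗ[MvPolynomial σ ℂ] M
  /-- the differentials preserve degrees -/
  d_homogeneous : ∀ i b a,
    d i (Pi.single b 1) a ∈ stdGrading σ (deg (i + 1) b - deg i a)
  /-- the augmentation preserves degrees -/
  ε_homogeneous : ∀ a, ε (Pi.single a 1) ∈ 𝓜 (deg 0 a)
  ε_surjective : Function.Surjective ε
  exact_zero : Function.Exact (d 0) ε
  exact_succ : ∀ i, Function.Exact (d (i + 1)) (d i)
  /-- minimality: the image of each differential lies in `𝔪 Fᵢ`, where `𝔪 = (x_s : s ∈ σ)` -/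
  minimal : ∀ i x a, d i x a ∈ idealOfVars σ ℂ

/-- The number of generators of degree `j` of the `i`-th free module of the resolution. -/
def MinimalGradedFreeResolution.betti {σ : Type} {M : Type*} [AddCommGroup M]
    [Module (MvPolynomial σ ℂ) M] {𝓜 : ℤ → AddSubgroup M}
    (F : MinimalGradedFreeResolution σ 𝓜) (i : ℕ) (j : ℤ) : ℕ :=
  (Finset.univ.filter fun a => F.deg i a = j).card

open Classical in
/-- The graded Betti number `β_{i,j}(M)`: the number of generators of degree `j` of the `i`-th module
in a minimal graded free resolution of `M`.  (A finitely generated graded module over a polynomial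
ring in finitely many variables has such a resolution, unique up to isomorphism.) -/
noncomputable def gradedBetti (σ : Type) {M : Type*} [AddCommGroup M]
    [Module (MvPolynomial σ ℂ) M] (𝓜 : ℤ → AddSubgroup M) (i : ℕ) (j : ℤ) : ℕ :=
  if h : Nonempty (MinimalGradedFreeResolution σ 𝓜) then h.some.betti i j else 0

/-- `(t₀, …, t_{ℓ-1})` is the maximal degree sequence of `M`: `tᵢ = max {j | β_{i,j}(M) ≠ 0}` for
`i < ℓ`, and `β_{i,j}(M) = 0` for all `i ≥ ℓ`. -/
def HasMaximalDegreeSequence (σ : Type) {M : Type*} [AddCommGroup M]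
    [Module (MvPolynomial σ ℂ) M] (𝓜 : ℤ → AddSubgroup M) {ℓ : ℕ} (t : Fin ℓ → ℤ) : Prop :=
  (∀ i : Fin ℓ, IsGreatest {j : ℤ | gradedBetti σ 𝓜 i j ≠ 0} (t i)) ∧
    ∀ i : ℕ, ℓ ≤ i → ∀ j : ℤ, gradedBetti σ 𝓜 i j = 0

/-- The Castelnuovo–Mumford regularity `max {j - i | β_{i,j}(M) ≠ 0}`. -/
noncomputable def regularity (σ : Type) {M : Type*} [AddCommGroup M]
    [Module (MvPolynomial σ ℂ) M] (𝓜 : ℤ → AddSubgroup M) : ℤ :=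
  sSup {m : ℤ | ∃ (i : ℕ) (j : ℤ), gradedBetti σ 𝓜 i j ≠ 0 ∧ m = j - i}

/-- The grading that an ideal inherits from the polynomial ring. -/
noncomputable def idealGrading {σ : Type} (J : Ideal (MvPolynomial σ ℂ)) : ℤ → AddSubgroup J :=
  fun j => (stdGrading σ j).toAddSubgroup.comap J.subtype.toAddMonoidHom

/-- The ideal `(y₁, …, y_N)` of the linear subspace `ℙⁿ ⊆ ℙⁿ⁺ᴺ` in
`ℂ[x₀, …, xₙ, y₁, …, y_N]`; the summand `Fin (n + 1)` indexes the `x`'s and `Fin N` the `y`'s. -/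
noncomputable def linearIdeal (n N : ℕ) : Ideal (MvPolynomial (Fin (n + 1) ⊕ Fin N) ℂ) :=
  Ideal.span (Set.range fun j : Fin N => X (Sum.inr j))

/-! Let `F` be a minimal resolution of `M` and `b` the rank of `F₀`. Multiplying the basis vectors
of `F₀` by powers of `x₀` embeds `F₀` into `R(-k)^b`. This changes the cokernel, but the image `V`
of `F₁` is still the first syzygy module of `M`, so its Betti numbers are those of `M` shifted by
one step. The bound on `b` provides `b` distinct monomials of degree `k` in the `y`'s. Let `J`
consist of those `f ∈ I^k` whose coefficients at these monomials form a vector in `V`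
(`coeffIdeal`). Then `I^(k+1) ⊆ J ⊆ I^k`, and there is an exact sequence `0 → J₀ → J → V → 0`, where
`J₀` belongs to the zero submodule and the `y`'s kill `V`.

Over `S` the Betti numbers of `V` are those over `R` tensored with an exterior algebra on `N`
generators of degree one (`koszulVanishes_sum_zero_iff`). Since the `tᵢ` increase strictly, the top
degrees are `t₁, …, t_r`, followed by `t_r + 1, …, t_r + N`. The ideal `J₀` is the kernel of `I^k →
R(-k)^b`, hence contributes only in homological degrees `i < N` and internal degrees at most `k + 1
+ i` (`koszulVanishes_coeffIdeal_bot`). As `t_{i+1} ≥ k + 1 + i`, it does not disturb the maxima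
(`exists_ideal_of_resolution`). If `r = 0` then `V = 0`, and `J = I^(t₀+1)` is used instead, whose
resolution is linear.

Betti numbers are handled through vanishing of Koszul homology, which does not depend on the chosen
resolution and has long exact sequences. Dimension shifting along minimal covers identifies the two
(`koszulVanishes_succ_iff_of_cover`, `koszulVanishes_zero_iff_of_cover`). -/

set_option linter.unusedSectionVars false

/-! ### Koszul homology of graded modules and its long exact sequence -/

section Koszul

variable {ι P Q : Type*} [AddCommGroup P] [AddCommGroup Q]

/-- The sign with which `e_l` moves into its place in the exterior monomial `e_s`, the variables being
ordered by `ρ`. -/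
def koszulSign (ρ : ι → ℕ) (l : ι) (s : Finset ι) : ℤ :=
  (-1) ^ (s.filter fun m => ρ m < ρ l).card

lemma koszulSign_mul_self (ρ : ι → ℕ) (l : ι) (s : Finset ι) :
    koszulSign ρ l s * koszulSign ρ l s = 1 := by
  simp [koszulSign, ← mul_pow]

variable [DecidableEq ι]

lemma koszulSign_insert (ρ : ι → ℕ) {l m : ι} {s : Finset ι} (hl : l ∉ s) :
    koszulSign ρ m (insert l s) = (if ρ l < ρ m then -1 else 1) * koszulSign ρ m s := by
  unfold koszulSign
  rw [Finset.filter_insert]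
  split_ifs
  · rw [Finset.card_insert_of_notMem (by simp [hl]), pow_succ]; ring
  · simp

lemma koszulSign_swap {ρ : ι → ℕ} (hρ : Function.Injective ρ) {l m : ι} {s : Finset ι}
    (hl : l ∉ s) (hm : m ∉ s) (hlm : l ≠ m) :
    koszulSign ρ l s * koszulSign ρ m (insert l s) =
      -(koszulSign ρ m s * koszulSign ρ l (insert m s)) := by
  rw [koszulSign_insert ρ hl, koszulSign_insert ρ hm]
  rcases lt_or_gt_of_ne (hρ.ne hlm) with h | h
  · rw [if_pos h, if_neg h.not_gt]; ring
  · rw [if_neg h.not_gt, if_pos h]; ring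

variable [Fintype ι]

/-- The Koszul differential of a family `x` of endomorphisms of `P`; the coefficient of the exterior
monomial `e_s` in a chain `ω` is `ω s`. -/
def koszulDiff (ρ : ι → ℕ) (x : ι → P →+ P) : (Finset ι → P) →+ (Finset ι → P) where
  toFun ω s := ∑ l ∈ sᶜ, koszulSign ρ l s • x l (ω (insert l s))
  map_zero' := by ext; simp
  map_add' ω η := by ext; simp [Finset.sum_add_distrib]

lemma koszulDiff_apply (ρ : ι → ℕ) (x : ι → P →+ P) (ω : Finset ι → P) (s : Finset ι) :
    koszulDiff ρ x ω s = ∑ l ∈ sᶜ, koszulSign ρ l s • x l (ω (insert l s)) := rfl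

lemma koszulDiff_koszulDiff {ρ : ι → ℕ} (hρ : Function.Injective ρ) {x : ι → P →+ P}
    (hx : ∀ l m p, x l (x m p) = x m (x l p)) (ω : Finset ι → P) :
    koszulDiff ρ x (koszulDiff ρ x ω) = 0 := by
  ext s
  simp only [koszulDiff_apply, map_sum, Finset.smul_sum, map_zsmul, smul_smul, Pi.zero_apply]
  rw [Finset.sum_sigma']
  -- Removing `l` then `m` cancels against removing `m` then `l`: the actions commute and the signs
  -- are opposite.
  refine Finset.sum_involution (fun a _ => ⟨a.2, a.1⟩) ?_ ?_ ?_ ?_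
  · rintro ⟨l, m⟩ h
    simp only [Finset.mem_sigma, Finset.mem_compl, Finset.mem_insert, not_or] at h
    obtain ⟨hl, hml, hm⟩ := h
    simp only
    rw [Finset.insert_comm l m, hx m l, koszulSign_swap hρ hl hm (Ne.symm hml), neg_smul,
      neg_add_cancel]
  · rintro ⟨l, m⟩ h - heq
    simp only [Finset.mem_sigma, Finset.mem_compl, Finset.mem_insert, not_or] at h
    exact h.2.1 (congrArg Sigma.fst heq)
  · rintro ⟨l, m⟩ h
    simp only [Finset.mem_sigma, Finset.mem_compl, Finset.mem_insert, not_or] at h ⊢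
    exact ⟨h.2.2, Ne.symm h.2.1, h.1⟩
  · rintro ⟨l, m⟩ h
    rfl

/-- `ω` is a chain of homological degree `i` and internal degree `j` of the Koszul complex of the
graded module `⨁ 𝓟`. -/
def IsKoszulChain (𝓟 : ℤ → AddSubgroup P) (i : ℕ) (j : ℤ) (ω : Finset ι → P) : Prop :=
  ∀ s, ω s ∈ 𝓟 (j - i) ∧ (s.card ≠ i → ω s = 0)

/-- The Koszul homology of `⨁ 𝓟` vanishes in homological degree `i` and internal degree `j`. -/
def KoszulVanishes (ρ : ι → ℕ) (x : ι → P →+ P) (𝓟 : ℤ → AddSubgroup P) (i : ℕ) (j : ℤ) : Prop :=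
  ∀ ω, IsKoszulChain 𝓟 i j ω → koszulDiff ρ x ω = 0 →
    ∃ η, IsKoszulChain 𝓟 (i + 1) j η ∧ koszulDiff ρ x η = ω

lemma IsKoszulChain.sub {𝓟 : ℤ → AddSubgroup P} {i : ℕ} {j : ℤ} {ω η : Finset ι → P}
    (hω : IsKoszulChain 𝓟 i j ω) (hη : IsKoszulChain 𝓟 i j η) : IsKoszulChain 𝓟 i j (ω - η) :=
  fun s => ⟨sub_mem (hω s).1 (hη s).1, fun h => by simp [(hω s).2 h, (hη s).2 h]⟩

lemma IsKoszulChain.add {𝓟 : ℤ → AddSubgroup P} {i : ℕ} {j : ℤ} {ω η : Finset ι → P}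
    (hω : IsKoszulChain 𝓟 i j ω) (hη : IsKoszulChain 𝓟 i j η) : IsKoszulChain 𝓟 i j (ω + η) :=
  fun s => ⟨add_mem (hω s).1 (hη s).1, fun h => by simp [(hω s).2 h, (hη s).2 h]⟩

lemma IsKoszulChain.diff (ρ : ι → ℕ) {x : ι → P →+ P} {𝓟 : ℤ → AddSubgroup P}
    (hx : ∀ l j p, p ∈ 𝓟 j → x l p ∈ 𝓟 (j + 1)) {i : ℕ} {j : ℤ} {ω : Finset ι → P}
    (hω : IsKoszulChain 𝓟 (i + 1) j ω) : IsKoszulChain 𝓟 i j (koszulDiff ρ x ω) := by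
  refine fun s => ⟨sum_mem fun l _ => zsmul_mem ?_ _, fun h => Finset.sum_eq_zero fun l hl => ?_⟩
  · have := hx l _ _ (hω (insert l s)).1
    rwa [show j - ((i + 1 : ℕ) : ℤ) + 1 = j - i by push_cast; ring] at this
  · rw [(hω _).2, map_zero, smul_zero]
    rw [Finset.card_insert_of_notMem (by simpa using hl)]
    lia

lemma koszulDiff_eq_zero_of_isKoszulChain_zero (ρ : ι → ℕ) (x : ι → P →+ P)
    {𝓟 : ℤ → AddSubgroup P} {j : ℤ} {ω : Finset ι → P} (hω : IsKoszulChain 𝓟 0 j ω) :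
    koszulDiff ρ x ω = 0 := by
  ext s
  refine Finset.sum_eq_zero fun l _ => ?_
  rw [(hω _).2 (by simp), map_zero, smul_zero]

lemma koszulDiff_comp (ρ : ι → ℕ) {x : ι → P →+ P} {y : ι → Q →+ Q} (g : P →+ Q)
    {ω : Finset ι → P} (hg : ∀ l s, g (x l (ω s)) = y l (g (ω s))) :
    koszulDiff ρ y (fun s => g (ω s)) = fun s => g (koszulDiff ρ x ω s) := by
  ext s
  simp [koszulDiff_apply, hg]

/-- An exact sequence `0 → ⨁ 𝓐 → ⨁ 𝓑 → ⨁ 𝓒 → 0` of graded modules, in which `𝓐` is the kernel of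
`g`, the variables acting on `𝓑` by `x` and on `𝓒` by `y`. -/
structure KoszulExact (x : ι → P →+ P) (y : ι → Q →+ Q) (𝓐 𝓑 : ℤ → AddSubgroup P)
    (𝓒 : ℤ → AddSubgroup Q) (g : P →+ Q) : Prop where
  comm : ∀ l m p, x l (x m p) = x m (x l p)
  mem_of_mem : ∀ l j p, p ∈ 𝓑 j → x l p ∈ 𝓑 (j + 1)
  mem_left : ∀ j p, p ∈ 𝓐 j ↔ p ∈ 𝓑 j ∧ g p = 0
  map_mem : ∀ j p, p ∈ 𝓑 j → g p ∈ 𝓒 j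
  exists_lift : ∀ j q, q ∈ 𝓒 j → ∃ p ∈ 𝓑 j, g p = q
  map_act : ∀ l j p, p ∈ 𝓑 j → g (x l p) = y l (g p)

namespace KoszulExact

variable {ρ : ι → ℕ} {x : ι → P →+ P} {y : ι → Q →+ Q} {𝓐 𝓑 : ℤ → AddSubgroup P}
    {𝓒 : ℤ → AddSubgroup Q} {g : P →+ Q} {i : ℕ} {j : ℤ}

lemma chain_of_left (E : KoszulExact x y 𝓐 𝓑 𝓒 g) {ω : Finset ι → P}
    (hω : IsKoszulChain 𝓐 i j ω) : IsKoszulChain 𝓑 i j ω :=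
  fun s => ⟨((E.mem_left _ _).1 (hω s).1).1, (hω s).2⟩

lemma chain_left (E : KoszulExact x y 𝓐 𝓑 𝓒 g) {ω : Finset ι → P}
    (hω : IsKoszulChain 𝓑 i j ω) (h : ∀ s, g (ω s) = 0) : IsKoszulChain 𝓐 i j ω :=
  fun s => ⟨(E.mem_left _ _).2 ⟨(hω s).1, h s⟩, (hω s).2⟩

lemma chain_map (E : KoszulExact x y 𝓐 𝓑 𝓒 g) {ω : Finset ι → P}
    (hω : IsKoszulChain 𝓑 i j ω) : IsKoszulChain 𝓒 i j fun s => g (ω s) :=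
  fun s => ⟨E.map_mem _ _ (hω s).1, fun h => by simp [(hω s).2 h]⟩

lemma diff_map (E : KoszulExact x y 𝓐 𝓑 𝓒 g) {ω : Finset ι → P}
    (hω : IsKoszulChain 𝓑 i j ω) :
    koszulDiff ρ y (fun s => g (ω s)) = fun s => g (koszulDiff ρ x ω s) :=
  koszulDiff_comp ρ g fun l s => E.map_act l _ _ (hω s).1

lemma chain_lift (E : KoszulExact x y 𝓐 𝓑 𝓒 g) {ω : Finset ι → Q}
    (hω : IsKoszulChain 𝓒 i j ω) :
    ∃ η : Finset ι → P, IsKoszulChain 𝓑 i j η ∧ (fun s => g (η s)) = ω := by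
  choose p hp hgp using fun s => E.exists_lift _ _ (hω s).1
  refine ⟨fun s => if s.card = i then p s else 0, fun s => ⟨?_, fun h => if_neg h⟩, ?_⟩
  · dsimp only
    split_ifs
    exacts [hp s, zero_mem _]
  · ext s
    dsimp only
    split_ifs with h
    exacts [hgp s, by rw [map_zero, (hω s).2 h]]

/-- Exactness of `H_{i+1}(𝓒) → H_i(𝓐) → H_i(𝓑)`. Only the vanishing of the second map is required,
not of `H_i(𝓑)`: for a minimal free cover in degree `i = 0` the target need not vanish, but the map
does. -/
lemma vanishes_left (E : KoszulExact x y 𝓐 𝓑 𝓒 g) (hρ : Function.Injective ρ)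
    (hB : ∀ ω, IsKoszulChain 𝓐 i j ω → koszulDiff ρ x ω = 0 →
      ∃ η, IsKoszulChain 𝓑 (i + 1) j η ∧ koszulDiff ρ x η = ω)
    (hC : KoszulVanishes ρ y 𝓒 (i + 1) j) : KoszulVanishes ρ x 𝓐 i j := by
  intro ω hω hd
  obtain ⟨η, hη, rfl⟩ := hB ω hω hd
  obtain ⟨ξ', hξ', h⟩ := hC _ (E.chain_map hη) (by
    rw [E.diff_map hη]
    ext s
    exact ((E.mem_left _ _).1 (hω s).1).2)
  obtain ⟨ξ, hξ, rfl⟩ := E.chain_lift hξ'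
  refine ⟨η - koszulDiff ρ x ξ, E.chain_left (hη.sub (hξ.diff ρ E.mem_of_mem)) fun s => ?_, ?_⟩
  · rw [E.diff_map hξ] at h
    simpa [sub_eq_zero] using (congrFun h s).symm
  · rw [map_sub, koszulDiff_koszulDiff hρ E.comm, sub_zero]

/-- Exactness of `H_{i+1}(𝓑) → H_{i+1}(𝓒) → H_i(𝓐)`, the connecting map being the differential of a
lift. -/
lemma vanishes_right (E : KoszulExact x y 𝓐 𝓑 𝓒 g) (hρ : Function.Injective ρ)
    (hA : KoszulVanishes ρ x 𝓐 i j) (hB : KoszulVanishes ρ x 𝓑 (i + 1) j) :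
    KoszulVanishes ρ y 𝓒 (i + 1) j := by
  intro ω' hω' hd
  obtain ⟨ω, hω, rfl⟩ := E.chain_lift hω'
  rw [E.diff_map hω] at hd
  obtain ⟨ζ, hζ, hζd⟩ := hA (koszulDiff ρ x ω)
    (E.chain_left (hω.diff ρ E.mem_of_mem) (congrFun hd)) (koszulDiff_koszulDiff hρ E.comm ω)
  obtain ⟨η, hη, h⟩ := hB _ (hω.sub (E.chain_of_left hζ)) (by rw [map_sub, hζd, sub_self])
  refine ⟨_, E.chain_map hη, ?_⟩
  rw [E.diff_map hη, h]
  ext s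
  simp [((E.mem_left _ _).1 (hζ s).1).2]

lemma vanishes_right_zero (E : KoszulExact x y 𝓐 𝓑 𝓒 g)
    (hB : KoszulVanishes ρ x 𝓑 0 j) : KoszulVanishes ρ y 𝓒 0 j := by
  intro ω' hω' _
  obtain ⟨ω, hω, rfl⟩ := E.chain_lift hω'
  obtain ⟨η, hη, h⟩ := hB _ hω (koszulDiff_eq_zero_of_isKoszulChain_zero ρ x hω)
  exact ⟨_, E.chain_map hη, by rw [E.diff_map hη, h]⟩

lemma vanishes_mid (E : KoszulExact x y 𝓐 𝓑 𝓒 g) (hρ : Function.Injective ρ)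
    (hA : KoszulVanishes ρ x 𝓐 i j) (hC : KoszulVanishes ρ y 𝓒 i j) :
    KoszulVanishes ρ x 𝓑 i j := by
  intro ω hω hd
  obtain ⟨η', hη', h⟩ := hC _ (E.chain_map hω) (by rw [E.diff_map hω, hd]; ext; simp)
  obtain ⟨η, hη, rfl⟩ := E.chain_lift hη'
  rw [E.diff_map hη] at h
  obtain ⟨ξ, hξ, hξd⟩ := hA (ω - koszulDiff ρ x η)
    (E.chain_left (hω.sub (hη.diff ρ E.mem_of_mem)) fun s => by
      simpa [sub_eq_zero] using (congrFun h s).symm)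
    (by rw [map_sub, hd, koszulDiff_koszulDiff hρ E.comm, sub_zero])
  exact ⟨ξ + η, (E.chain_of_left hξ).add hη, by rw [map_add, hξd, sub_add_cancel]⟩

end KoszulExact

/-- Koszul homology only depends on the graded module up to isomorphism. -/
lemma koszulVanishes_map_iff {ρ : ι → ℕ} {x : ι → P →+ P} {y : ι → Q →+ Q}
    {𝓟 : ℤ → AddSubgroup P} {f : P →+ Q} (hf : Function.Injective f)
    (hfx : ∀ l p, f (x l p) = y l (f p)) {i : ℕ} {j : ℤ} :
    KoszulVanishes ρ y (fun a => (𝓟 a).map f) i j ↔ KoszulVanishes ρ x 𝓟 i j := by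
  have lift : ∀ {a : ℕ} {ω : Finset ι → Q}, IsKoszulChain (fun a => (𝓟 a).map f) a j ω →
      ∃ η : Finset ι → P, IsKoszulChain 𝓟 a j η ∧ (fun s => f (η s)) = ω := by
    intro a ω hω
    choose η hη hηf using fun s => (hω s).1
    refine ⟨η, fun s => ⟨hη s, fun h => hf ?_⟩, funext hηf⟩
    rw [hηf, map_zero, (hω s).2 h]
  have push : ∀ {a : ℕ} {ω : Finset ι → P}, IsKoszulChain 𝓟 a j ω →
      IsKoszulChain (fun a => (𝓟 a).map f) a j (fun s => f (ω s)) := fun hω s =>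
    ⟨⟨_, (hω s).1, rfl⟩, fun h => by simp [(hω s).2 h]⟩
  have comp : ∀ ω : Finset ι → P, koszulDiff ρ y (fun s => f (ω s)) =
      fun s => f (koszulDiff ρ x ω s) := fun ω => koszulDiff_comp ρ f fun l s => hfx l _
  constructor
  · intro H ω hω hd
    obtain ⟨η', hη', h⟩ := H _ (push hω) (by rw [comp, hd]; ext; simp)
    obtain ⟨η, hη, rfl⟩ := lift hη'
    refine ⟨η, hη, funext fun s => hf ?_⟩
    rw [comp] at h
    exact congrFun h s
  · intro H ω' hω' hd
    obtain ⟨ω, hω, rfl⟩ := lift hω'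
    rw [comp] at hd
    obtain ⟨η, hη, h⟩ := H ω hω (funext fun s => hf (by simpa using congrFun hd s))
    exact ⟨_, push hη, by rw [comp, h]⟩

end Koszul

/-! ### Acyclicity of the Koszul complex of a free module; minimal covers -/

section Polynomial

variable {σ : Type}

lemma mem_stdGrading {j : ℤ} {f : MvPolynomial σ ℂ} :
    f ∈ stdGrading σ j ↔ ∀ m, coeff m f ≠ 0 → (m.degree : ℤ) = j := by
  have : ∀ m : σ →₀ ℕ, Finsupp.weight (fun _ : σ => (1 : ℤ)) m = (m.degree : ℤ) := by
    intro m
    simp [Finsupp.weight_apply, Finsupp.sum, Finsupp.degree_apply]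
  simp only [mem_weightedHomogeneousSubmodule, IsWeightedHomogeneous, this]

lemma eq_zero_of_mem_stdGrading_neg {j : ℤ} (hj : j < 0) {f : MvPolynomial σ ℂ}
    (hf : f ∈ stdGrading σ j) : f = 0 := by
  ext m
  by_contra h
  have := mem_stdGrading.1 hf m h
  lia

lemma X_mul_mem_stdGrading (l : σ) {j : ℤ} {f : MvPolynomial σ ℂ} (hf : f ∈ stdGrading σ j) :
    X l * f ∈ stdGrading σ (j + 1) := by
  rw [add_comm]
  exact (isWeightedHomogeneous_X ℂ _ l).mul hf

lemma sum_X_mul_pderiv_of_mem [Fintype σ] {j : ℤ} {f : MvPolynomial σ ℂ}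
    (hf : f ∈ stdGrading σ j) : ∑ l, X l * pderiv l f = j • f := by
  rcases lt_or_ge j 0 with hj | hj
  · simp [eq_zero_of_mem_stdGrading_neg hj hf]
  · lift j to ℕ using hj
    rw [IsHomogeneous.sum_X_mul_pderiv (n := j), natCast_zsmul]
    intro m hm
    have := mem_stdGrading.1 hf m hm
    rw [Pi.one_def, ← Finsupp.degree_eq_weight_one]
    exact_mod_cast this

/-- The action of the variables on a module over a polynomial ring. -/
noncomputable def varAct (σ : Type) (P : Type*) [AddCommGroup P] [Module (MvPolynomial σ ℂ) P] (l : σ) :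
    P →+ P :=
  DistribSMul.toAddMonoidHom P (X l : MvPolynomial σ ℂ)

@[simp] lemma varAct_apply {P : Type*} [AddCommGroup P] [Module (MvPolynomial σ ℂ) P] (l : σ) (p : P) :
    varAct σ P l p = (X l : MvPolynomial σ ℂ) • p := rfl

variable [Fintype σ] [DecidableEq σ]

/-- Exterior differentiation of polynomial differential forms. -/
noncomputable def polyExtDeriv (ρ : σ → ℕ) (ω : Finset σ → MvPolynomial σ ℂ) (s : Finset σ) :
    MvPolynomial σ ℂ :=
  ∑ m ∈ s, koszulSign ρ m (s.erase m) • pderiv m (ω (s.erase m))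

lemma koszulSign_erase_swap {ρ : σ → ℕ} (hρ : Function.Injective ρ) {l m : σ} {s : Finset σ}
    (hl : l ∉ s) (hm : m ∈ s) :
    koszulSign ρ l s * koszulSign ρ m (insert l (s.erase m)) =
      -(koszulSign ρ m (s.erase m) * koszulSign ρ l (s.erase m)) := by
  obtain ⟨s, hms, rfl⟩ : ∃ s', m ∉ s' ∧ insert m s' = s :=
    ⟨s.erase m, Finset.notMem_erase m s, Finset.insert_erase hm⟩
  rw [Finset.erase_insert hms]
  simp only [Finset.mem_insert, not_or] at hl
  rw [koszulSign_insert ρ hms, koszulSign_insert ρ hl.2]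
  rcases lt_or_gt_of_ne (hρ.ne hl.1) with h | h
  · rw [if_pos h, if_neg h.not_gt]; ring
  · rw [if_neg h.not_gt, if_pos h]; ring

/-- Cartan's formula: the Koszul differential is contraction with the Euler vector field, so its
anticommutator with the exterior derivative is the Lie derivative. The first summand on the right
acts on the coefficient, the second on the exterior monomial. -/
lemma koszulDiff_polyExtDeriv_add {ρ : σ → ℕ} (hρ : Function.Injective ρ)
    (ω : Finset σ → MvPolynomial σ ℂ) (s : Finset σ) :
    koszulDiff ρ (varAct σ (MvPolynomial σ ℂ)) (polyExtDeriv ρ ω) s +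
      polyExtDeriv ρ (koszulDiff ρ (varAct σ (MvPolynomial σ ℂ)) ω) s =
      ∑ l, X l * pderiv l (ω s) + s.card • ω s := by
  have h1 : koszulDiff ρ (varAct σ (MvPolynomial σ ℂ)) (polyExtDeriv ρ ω) s =
      ∑ l ∈ sᶜ, X l * pderiv l (ω s) + ∑ l ∈ sᶜ, ∑ m ∈ s,
        (koszulSign ρ l s * koszulSign ρ m (insert l (s.erase m))) •
          (X l * pderiv m (ω (insert l (s.erase m)))) := by
    rw [koszulDiff_apply, ← Finset.sum_add_distrib]
    refine Finset.sum_congr rfl fun l hl => ?_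
    have hl' : l ∉ s := by simpa using hl
    rw [polyExtDeriv, Finset.sum_insert hl', Finset.erase_insert hl', map_add, smul_add, map_zsmul,
      smul_smul, koszulSign_mul_self, one_smul, varAct_apply, smul_eq_mul, map_sum, Finset.smul_sum]
    congr 1
    refine Finset.sum_congr rfl fun m hm => ?_
    have hlm : l ≠ m := fun h => hl' (h ▸ hm)
    rw [map_zsmul, smul_smul, varAct_apply, smul_eq_mul, Finset.erase_insert_of_ne hlm]
  have h2 : polyExtDeriv ρ (koszulDiff ρ (varAct σ (MvPolynomial σ ℂ)) ω) s =
      (∑ m ∈ s, X m * pderiv m (ω s) + s.card • ω s) + ∑ m ∈ s, ∑ l ∈ sᶜ,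
        (koszulSign ρ m (s.erase m) * koszulSign ρ l (s.erase m)) •
          (X l * pderiv m (ω (insert l (s.erase m)))) := by
    rw [← Finset.sum_const, ← Finset.sum_add_distrib, ← Finset.sum_add_distrib, polyExtDeriv]
    refine Finset.sum_congr rfl fun m hm => ?_
    rw [koszulDiff_apply, Finset.compl_erase, Finset.sum_insert (by simpa using hm), map_add,
      smul_add, map_zsmul, smul_smul, koszulSign_mul_self, one_smul, varAct_apply, smul_eq_mul,
      Finset.insert_erase hm, Derivation.leibniz, pderiv_X_self, smul_eq_mul, smul_eq_mul, mul_one,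
      map_sum, Finset.smul_sum]
    congr 1
    refine Finset.sum_congr rfl fun l hl => ?_
    have hlm : l ≠ m := fun h => by simp [h, hm] at hl
    rw [map_zsmul, smul_smul, varAct_apply, smul_eq_mul, Derivation.leibniz, pderiv_X_of_ne hlm,
      smul_zero, add_zero, smul_eq_mul]
  rw [h1, h2, Finset.sum_comm, ← Finset.sum_add_sum_compl s]
  have h3 : ∑ m ∈ s, ∑ l ∈ sᶜ, (koszulSign ρ l s * koszulSign ρ m (insert l (s.erase m))) •
          (X l * pderiv m (ω (insert l (s.erase m)))) = - ∑ m ∈ s, ∑ l ∈ sᶜ,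
        (koszulSign ρ m (s.erase m) * koszulSign ρ l (s.erase m)) •
          (X l * pderiv m (ω (insert l (s.erase m)))) := by
    simp_rw [← Finset.sum_neg_distrib]
    refine Finset.sum_congr rfl fun m hm => Finset.sum_congr rfl fun l hl => ?_
    rw [koszulSign_erase_swap hρ (by simpa using hl) hm, neg_smul]
  rw [h3]
  abel

/-- The Poincaré lemma for polynomial forms: on internal degree `j` the Lie derivative along the
Euler field is multiplication by `j`, so the exterior derivative divided by `j` is a contracting
homotopy in characteristic zero. -/
lemma koszulVanishes_polynomial {ρ : σ → ℕ} (hρ : Function.Injective ρ) {i : ℕ} {j : ℤ}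
    (h : i ≠ 0 ∨ j ≠ 0) :
    KoszulVanishes ρ (varAct σ (MvPolynomial σ ℂ)) (fun a => (stdGrading σ a).toAddSubgroup) i j := by
  intro ω hω hd
  by_cases hj : j = 0
  -- Here `i ≠ 0`, so the coefficients have degree `-i < 0` and the chain is zero.
  · refine ⟨0, fun s => ⟨zero_mem _, fun _ => rfl⟩, ?_⟩
    rw [map_zero]
    ext1 s
    exact (eq_zero_of_mem_stdGrading_neg (by lia) (hω s).1).symm
  have hc : (j : ℂ) ≠ 0 := by exact_mod_cast hj
  refine ⟨fun s => (j : ℂ)⁻¹ • polyExtDeriv ρ ω s, fun s => ⟨?_, fun hs => ?_⟩, ?_⟩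
  · refine Submodule.smul_mem _ _ (Submodule.sum_mem _ fun m _ => zsmul_mem ?_ _)
    refine IsWeightedHomogeneous.pderiv (hω _).1 ?_
    push_cast; ring
  · dsimp only
    rw [polyExtDeriv, Finset.sum_eq_zero, smul_zero]
    intro m hm
    rw [(hω _).2, map_zero, smul_zero]
    have := Finset.card_erase_add_one hm
    lia
  · let c : MvPolynomial σ ℂ →+ MvPolynomial σ ℂ := DistribSMul.toAddMonoidHom _ (j : ℂ)⁻¹
    have h1 := koszulDiff_comp ρ (x := varAct σ (MvPolynomial σ ℂ)) (y := varAct σ (MvPolynomial σ ℂ)) c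
      (ω := polyExtDeriv ρ ω) (fun l s => by simp [c])
    refine h1.trans ?_
    ext1 s
    have h2 := koszulDiff_polyExtDeriv_add hρ ω s
    rw [hd, sum_X_mul_pderiv_of_mem (hω s).1] at h2
    have h3 : polyExtDeriv ρ 0 s = 0 := by simp [polyExtDeriv]
    rw [h3, add_zero] at h2
    simp only [c, DistribSMul.toAddMonoidHom_apply]
    rw [h2, inv_smul_eq_iff₀ hc]
    by_cases hs : s.card = i
    · rw [hs, ← natCast_zsmul, ← add_smul, sub_add_cancel, Int.cast_smul_eq_zsmul]
    · simp [(hω s).2 hs]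

/-- The grading of the free module with generators in degrees `deg a`. -/
noncomputable def freeGrading {α : Type*} (deg : α → ℤ) (j : ℤ) : AddSubgroup (α → MvPolynomial σ ℂ) :=
  AddSubgroup.pi Set.univ fun a => (stdGrading σ (j - deg a)).toAddSubgroup

lemma mem_freeGrading {α : Type*} {deg : α → ℤ} {j : ℤ} {v : α → MvPolynomial σ ℂ} :
    v ∈ freeGrading deg j ↔ ∀ a, v a ∈ stdGrading σ (j - deg a) := by
  simp [freeGrading, AddSubgroup.mem_pi]

lemma exists_koszulDiff_freeGrading {ρ : σ → ℕ} {α : Type*} {deg : α → ℤ} {i : ℕ} {j : ℤ}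
    {ω : Finset σ → α → MvPolynomial σ ℂ}
    (h : ∀ a, ∃ η, IsKoszulChain (fun b => (stdGrading σ b).toAddSubgroup) (i + 1) (j - deg a) η ∧
      koszulDiff ρ (varAct σ (MvPolynomial σ ℂ)) η = fun s => ω s a) :
    ∃ η, IsKoszulChain (freeGrading deg) (i + 1) j η ∧
      koszulDiff ρ (varAct σ (α → MvPolynomial σ ℂ)) η = ω := by
  choose η hη hd using h
  refine ⟨fun s a => η a s, fun s => ⟨mem_freeGrading.2 fun a => ?_, fun hs => ?_⟩, ?_⟩
  · rw [sub_right_comm]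
    exact (hη a s).1
  · ext1 a
    exact (hη a s).2 hs
  · ext1 s
    ext1 a
    rw [← congrFun (hd a) s]
    simp [koszulDiff_apply, mul_left_comm]

lemma IsKoszulChain.apply {α : Type*} {deg : α → ℤ} {i : ℕ} {j : ℤ}
    {ω : Finset σ → α → MvPolynomial σ ℂ} (hω : IsKoszulChain (freeGrading deg) i j ω) (a : α) :
    IsKoszulChain (fun b => (stdGrading σ b).toAddSubgroup) i (j - deg a) (fun s => ω s a) :=
  fun s => ⟨by
    rw [sub_right_comm]
    exact mem_freeGrading.1 (hω s).1 a, fun hs => congrFun ((hω s).2 hs) a⟩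

lemma koszulDiff_apply_apply (ρ : σ → ℕ) {α : Type*} (ω : Finset σ → α → MvPolynomial σ ℂ) (a : α) :
    koszulDiff ρ (varAct σ (MvPolynomial σ ℂ)) (fun s => ω s a) =
      fun s => koszulDiff ρ (varAct σ (α → MvPolynomial σ ℂ)) ω s a := by
  ext1 s
  simp [koszulDiff_apply, mul_left_comm]

lemma koszulVanishes_freeGrading {ρ : σ → ℕ} (hρ : Function.Injective ρ) {α : Type*} {deg : α → ℤ}
    {i : ℕ} {j : ℤ} (h : i ≠ 0 ∨ ∀ a, deg a ≠ j) :
    KoszulVanishes ρ (varAct σ (α → MvPolynomial σ ℂ)) (freeGrading deg) i j := by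
  intro ω hω hd
  refine exists_koszulDiff_freeGrading fun a => ?_
  refine koszulVanishes_polynomial hρ (h.imp_right fun h => ?_) _ (hω.apply a) ?_
  · rw [sub_ne_zero]
    exact (h a).symm
  · rw [koszulDiff_apply_apply, hd]
    rfl

lemma eq_zero_of_mem_idealOfVars {f : MvPolynomial σ ℂ} (hf : f ∈ stdGrading σ 0)
    (h : f ∈ idealOfVars σ ℂ) : f = 0 := by
  rw [← pow_one (idealOfVars σ ℂ), mem_pow_idealOfVars_iff'] at h
  ext m
  by_contra hm
  refine hm (h m ?_)
  have := mem_stdGrading.1 hf m hm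
  lia

/-- The homology of a free module is spanned by its basis vectors in homological degree `0`, and
coefficients in the maximal ideal have no constant part there. Hence the syzygies of a minimal cover
map to zero in homology. -/
lemma exists_koszulDiff_of_mem_idealOfVars {ρ : σ → ℕ} (hρ : Function.Injective ρ) {α : Type*}
    {deg : α → ℤ} {i : ℕ} {j : ℤ} {ω : Finset σ → α → MvPolynomial σ ℂ}
    (hω : IsKoszulChain (freeGrading deg) i j ω)
    (hd : koszulDiff ρ (varAct σ (α → MvPolynomial σ ℂ)) ω = 0)
    (hm : ∀ s a, ω s a ∈ idealOfVars σ ℂ) :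
    ∃ η, IsKoszulChain (freeGrading deg) (i + 1) j η ∧
      koszulDiff ρ (varAct σ (α → MvPolynomial σ ℂ)) η = ω := by
  refine exists_koszulDiff_freeGrading fun a => ?_
  by_cases h : i ≠ 0 ∨ j - deg a ≠ 0
  · refine koszulVanishes_polynomial hρ h _ (hω.apply a) ?_
    rw [koszulDiff_apply_apply, hd]
    rfl
  · refine ⟨0, fun s => ⟨zero_mem _, fun _ => rfl⟩, ?_⟩
    rw [map_zero]
    ext1 s
    push Not at h
    refine (eq_zero_of_mem_idealOfVars ?_ (hm s a)).symm
    have := (hω.apply a s).1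
    rwa [h.1, h.2] at this

section Cover

variable {ρ : σ → ℕ} {C : Type*} [AddCommGroup C] [Module (MvPolynomial σ ℂ) C]
  {𝓒 : ℤ → AddSubgroup C} {α : Type*} {deg : α → ℤ} {g : (α → MvPolynomial σ ℂ) →ₗ[MvPolynomial σ ℂ] C}
  {𝓩 : ℤ → AddSubgroup (α → MvPolynomial σ ℂ)}

lemma koszulExact_cover (h𝓩 : ∀ j v, v ∈ 𝓩 j ↔ v ∈ freeGrading deg j ∧ g v = 0)
    (hmap : ∀ j v, v ∈ freeGrading deg j → g v ∈ 𝓒 j)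
    (hlift : ∀ j c, c ∈ 𝓒 j → ∃ v ∈ freeGrading deg j, g v = c) :
    KoszulExact (varAct σ (α → MvPolynomial σ ℂ)) (varAct σ C) 𝓩 (freeGrading deg) 𝓒
      g.toAddMonoidHom where
  comm l m p := by simp [smul_smul, mul_comm]
  mem_of_mem l j p hp := mem_freeGrading.2 fun a => by
    rw [show j + 1 - deg a = j - deg a + 1 by ring]
    exact X_mul_mem_stdGrading l (mem_freeGrading.1 hp a)
  mem_left := h𝓩
  map_mem := hmap
  exists_lift := hlift
  map_act l j p _ := by simp

/-- Dimension shifting along a minimal free cover. -/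
lemma koszulVanishes_succ_iff_of_cover (hρ : Function.Injective ρ)
    (h𝓩 : ∀ j v, v ∈ 𝓩 j ↔ v ∈ freeGrading deg j ∧ g v = 0)
    (hmap : ∀ j v, v ∈ freeGrading deg j → g v ∈ 𝓒 j)
    (hlift : ∀ j c, c ∈ 𝓒 j → ∃ v ∈ freeGrading deg j, g v = c)
    (hmin : ∀ v, g v = 0 → ∀ a, v a ∈ idealOfVars σ ℂ) (i : ℕ) (j : ℤ) :
    KoszulVanishes ρ (varAct σ C) 𝓒 (i + 1) j ↔
      KoszulVanishes ρ (varAct σ (α → MvPolynomial σ ℂ)) 𝓩 i j := by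
  have E := koszulExact_cover h𝓩 hmap hlift
  refine ⟨fun h => E.vanishes_left hρ (fun ω hω hd => ?_) h, fun h => E.vanishes_right hρ h
    (koszulVanishes_freeGrading hρ (Or.inl i.succ_ne_zero))⟩
  exact exists_koszulDiff_of_mem_idealOfVars hρ (E.chain_of_left hω) hd
    fun s => hmin _ ((h𝓩 _ _).1 (hω s).1).2

/-- `H₀` is the module modulo the variables. If the class of a basis vector vanished, minimality
would put that vector into the maximal ideal times the free module, hence `1` into the maximal
ideal. -/
lemma koszulVanishes_zero_iff_of_cover [DecidableEq α] (hρ : Function.Injective ρ)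
    (hmap : ∀ j v, v ∈ freeGrading deg j → g v ∈ 𝓒 j)
    (hlift : ∀ j c, c ∈ 𝓒 j → ∃ v ∈ freeGrading deg j, g v = c)
    (hmin : ∀ v, g v = 0 → ∀ a, v a ∈ idealOfVars σ ℂ) (j : ℤ) :
    KoszulVanishes ρ (varAct σ C) 𝓒 0 j ↔ ∀ a, deg a ≠ j := by
  have E := koszulExact_cover (𝓩 := fun j => freeGrading deg j ⊓ g.toAddMonoidHom.ker)
    (fun j v => by simp [AddSubgroup.mem_inf, AddMonoidHom.mem_ker]) hmap hlift
  refine ⟨?_, fun h => E.vanishes_right_zero (koszulVanishes_freeGrading hρ (Or.inr h))⟩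
  rintro H a rfl
  let ω : Finset σ → α → MvPolynomial σ ℂ := fun s => if s = ∅ then Pi.single a 1 else 0
  have hω : IsKoszulChain (freeGrading deg) 0 (deg a) ω := by
    refine fun s => ⟨?_, fun hs => if_neg fun h => hs (by simp [h])⟩
    dsimp only [ω]
    split_ifs
    · refine mem_freeGrading.2 fun b => ?_
      by_cases hb : b = a
      · subst hb
        simpa using isWeightedHomogeneous_one ℂ _
      · simp [hb]
    · exact zero_mem _
  obtain ⟨η', hη', h⟩ := H _ (E.chain_map hω)
    (koszulDiff_eq_zero_of_isKoszulChain_zero ρ _ (E.chain_map hω))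
  obtain ⟨η, hη, rfl⟩ := E.chain_lift hη'
  rw [E.diff_map hη] at h
  have h1 := hmin (ω ∅ - koszulDiff ρ (varAct σ _) η ∅) (by
    rw [map_sub, sub_eq_zero]
    exact (congrFun h ∅).symm) a
  have h2 : koszulDiff ρ (varAct σ _) η ∅ a ∈ idealOfVars σ ℂ := by
    rw [koszulDiff_apply, Finset.sum_apply]
    refine sum_mem fun l _ => ?_
    rw [Pi.smul_apply]
    refine zsmul_mem ?_ _
    exact Ideal.mul_mem_right _ _ (Ideal.subset_span ⟨l, rfl⟩)
  have h3 : (1 : MvPolynomial σ ℂ) ∈ idealOfVars σ ℂ := by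
    have := add_mem h1 h2
    simpa [ω] using this
  rw [← pow_one (idealOfVars σ ℂ), mem_pow_idealOfVars_iff'] at h3
  simpa using h3 0 (by simp)

end Cover

end Polynomial

/-! ### Koszul homology when some variables act by zero -/

section ZeroVariables

variable {σ τ : Type} [Fintype σ] [Fintype τ] [DecidableEq σ] [DecidableEq τ]
  {P : Type*} [AddCommGroup P] {ρ : σ ⊕ τ → ℕ} {x : σ → P →+ P} {𝓟 : ℤ → AddSubgroup P}

/-- With the `τ`-part `t` of the exterior monomial fixed, only variables in `σ` contribute. As these
come first in the order, `t` does not enter the signs, so the complex is a direct sum over `t`. -/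
lemma koszulDiff_sum_zero (hρ : ∀ l m, ρ (Sum.inl l) < ρ (Sum.inr m))
    (ω : Finset (σ ⊕ τ) → P) (s : Finset σ) (t : Finset τ) :
    koszulDiff ρ (Sum.elim x 0) ω (s.disjSum t) =
      koszulDiff (ρ ∘ Sum.inl) x (fun s => ω (s.disjSum t)) s := by
  have hc : (s.disjSum t)ᶜ = sᶜ.disjSum tᶜ := by
    ext (a | a) <;> simp
  rw [koszulDiff_apply, koszulDiff_apply, hc, Finset.sum_disjSum]
  simp only [Sum.elim_inl, Sum.elim_inr, Pi.zero_apply, AddMonoidHom.zero_apply, smul_zero,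
    Finset.sum_const_zero, add_zero]
  refine Finset.sum_congr rfl fun l _ => ?_
  have h1 : koszulSign ρ (Sum.inl l) (s.disjSum t) = koszulSign (ρ ∘ Sum.inl) l s := by
    have : (s.disjSum t).filter (fun m => ρ m < ρ (Sum.inl l)) =
        (s.filter fun m => (ρ ∘ Sum.inl) m < (ρ ∘ Sum.inl) l).disjSum ∅ := by
      ext (a | a)
      · simp
      · simp [(hρ l a).le]
    simp [koszulSign, this]
  have h2 : insert (Sum.inl l) (s.disjSum t) = (insert l s).disjSum t := by
    ext (a | a) <;> simp
  rw [h1, h2]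

/-- The Koszul homology of a module on which the variables in `τ` act by zero is the tensor product of
the Koszul homology over the variables in `σ` with an exterior algebra. -/
lemma koszulVanishes_sum_zero_iff (hρ : ∀ l m, ρ (Sum.inl l) < ρ (Sum.inr m)) (i : ℕ) (j : ℤ) :
    KoszulVanishes ρ (Sum.elim x 0) 𝓟 i j ↔ ∀ a b, a + b = i → b ≤ Fintype.card τ →
      KoszulVanishes (ρ ∘ Sum.inl) x 𝓟 a (j - b) := by
  constructor
  · rintro H a b rfl hb ω hω hd
    rw [← Finset.card_univ] at hb
    obtain ⟨t, -, rfl⟩ := Finset.exists_subset_card_eq hb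
    -- The cycle is placed on the single summand `t`; the bound on `b` ensures that some `t` of this
    -- size exists.
    obtain ⟨η, hη, h⟩ := H (fun u => if u.toRight = t then ω u.toLeft else 0) (fun u => by
      dsimp only
      split_ifs with hu
      · refine ⟨?_, fun h => (hω _).2 fun h' => h ?_⟩
        · have := (hω u.toLeft).1
          rwa [show j - ((a + t.card : ℕ) : ℤ) = j - t.card - a by push_cast; ring]
        · rw [← Finset.card_toLeft_add_card_toRight, h', hu]
      · exact ⟨zero_mem _, fun _ => rfl⟩) (by
      ext1 u
      rw [← Finset.toLeft_disjSum_toRight (u := u), koszulDiff_sum_zero hρ]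
      simp only [Finset.toRight_disjSum, Finset.toLeft_disjSum]
      split_ifs
      · exact congrFun hd _
      · exact congrFun (map_zero (koszulDiff (ρ ∘ Sum.inl) x)) _)
    refine ⟨fun s => η (s.disjSum t), fun s => ⟨?_, fun h' => (hη _).2 ?_⟩, ?_⟩
    · have := (hη (s.disjSum t)).1
      rwa [show j - ((a + t.card + 1 : ℕ) : ℤ) = j - t.card - (a + 1 : ℕ) by push_cast; ring]
        at this
    · rw [Finset.card_disjSum]
      lia
    · ext1 s
      rw [← koszulDiff_sum_zero hρ, h]
      simp
  · intro H ω hω hd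
    have key : ∀ t : Finset τ, ∃ η : Finset σ → P,
        (∀ s, η s ∈ 𝓟 (j - (i + 1 : ℕ)) ∧ (s.card + t.card ≠ i + 1 → η s = 0)) ∧
          koszulDiff (ρ ∘ Sum.inl) x η = fun s => ω (s.disjSum t) := by
      intro t
      by_cases ht : t.card ≤ i
      · obtain ⟨a, rfl⟩ := Nat.exists_eq_add_of_le' ht
        obtain ⟨η, hη, h⟩ := H a t.card rfl t.card_le_univ (fun s => ω (s.disjSum t)) (fun s => by
          refine ⟨?_, fun h => (hω _).2 ?_⟩
          · have := (hω (s.disjSum t)).1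
            rwa [show j - ((a + t.card : ℕ) : ℤ) = j - t.card - a by push_cast; ring] at this
          · rw [Finset.card_disjSum]
            lia) (by
          ext1 s
          rw [← koszulDiff_sum_zero hρ, hd]
          rfl)
        refine ⟨η, fun s => ⟨?_, fun hs => (hη s).2 (by lia)⟩, h⟩
        have := (hη s).1
        rwa [show j - (t.card : ℤ) - (a + 1 : ℕ) = j - ((a + t.card + 1 : ℕ) : ℤ) by
          push_cast; ring] at this
      · refine ⟨0, fun s => ⟨zero_mem _, fun _ => rfl⟩, ?_⟩
        rw [map_zero]
        ext1 s
        refine ((hω _).2 ?_).symm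
        rw [Finset.card_disjSum]
        lia
    choose η hη hηd using key
    refine ⟨fun u => η u.toRight u.toLeft, fun u => ⟨(hη _ _).1, fun hu => (hη _ _).2 ?_⟩, ?_⟩
    · rwa [Finset.card_toLeft_add_card_toRight]
    · ext1 u
      rw [← Finset.toLeft_disjSum_toRight (u := u), koszulDiff_sum_zero hρ]
      simp only [Finset.toRight_disjSum]
      simp only [Finset.toLeft_disjSum]
      exact congrFun (hηd _) _

end ZeroVariables

/-! ### Minimal resolutions of ideals; Betti numbers as Koszul homology -/

section Resolution

variable {σ : Type} [Fintype σ] [DecidableEq σ]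

/-- The matrix of the linear map `f` has homogeneous entries of the degrees that make `f` a graded map. -/
def IsGradedMap {α β : Type*} [DecidableEq α] (degα : α → ℤ) (degβ : β → ℤ)
    (f : (α → MvPolynomial σ ℂ) →ₗ[MvPolynomial σ ℂ] (β → MvPolynomial σ ℂ)) : Prop :=
  ∀ a b, f (Pi.single a 1) b ∈ stdGrading σ (degα a - degβ b)

/-- The homogeneous component of degree `j` of an element of a graded free module. -/
noncomputable def freeComponent {α : Type*} (deg : α → ℤ) (j : ℤ) (v : α → MvPolynomial σ ℂ) :
    α → MvPolynomial σ ℂ :=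
  fun a => GradedRing.proj (stdGrading σ) (j - deg a) (v a)

lemma freeComponent_mem {α : Type*} (deg : α → ℤ) (j : ℤ) (v : α → MvPolynomial σ ℂ) :
    freeComponent deg j v ∈ freeGrading deg j :=
  mem_freeGrading.2 fun _ => SetLike.coe_mem _

lemma freeComponent_of_mem {α : Type*} {deg : α → ℤ} {j : ℤ} {v : α → MvPolynomial σ ℂ}
    (hv : v ∈ freeGrading deg j) : freeComponent deg j v = v :=
  funext fun a => DirectSum.decompose_of_mem_same _ (mem_freeGrading.1 hv a)

lemma proj_mul_of_mem {e n : ℤ} (p : MvPolynomial σ ℂ) {h : MvPolynomial σ ℂ}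
    (hh : h ∈ stdGrading σ e) :
    GradedRing.proj (stdGrading σ) n (p * h) = GradedRing.proj (stdGrading σ) (n - e) p * h := by
  have := DirectSum.coe_decompose_mul_add_of_right_mem (stdGrading σ) (i := n - e) (a := p) hh
  rwa [sub_add_cancel] at this

lemma linearMap_apply_eq_sum {α C : Type*} [Fintype α] [DecidableEq α] [AddCommGroup C]
    [Module (MvPolynomial σ ℂ) C] (f : (α → MvPolynomial σ ℂ) →ₗ[MvPolynomial σ ℂ] C)
    (v : α → MvPolynomial σ ℂ) : f v = ∑ a, v a • f (Pi.single a 1) := by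
  conv_lhs => rw [pi_eq_sum_univ' v]
  simp only [map_sum, map_smul]

variable {α β : Type*} [Fintype α] [DecidableEq α] {degα : α → ℤ} {degβ : β → ℤ}

lemma freeComponent_map {f : (α → MvPolynomial σ ℂ) →ₗ[MvPolynomial σ ℂ] (β → MvPolynomial σ ℂ)}
    (hf : IsGradedMap degα degβ f) (j : ℤ) (v : α → MvPolynomial σ ℂ) :
    freeComponent degβ j (f v) = f (freeComponent degα j v) := by
  ext1 b
  rw [linearMap_apply_eq_sum f v, linearMap_apply_eq_sum f]
  simp only [freeComponent, Finset.sum_apply, Pi.smul_apply, smul_eq_mul, map_sum]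
  refine Finset.sum_congr rfl fun a _ => ?_
  rw [proj_mul_of_mem _ (hf a b)]
  congr 3
  ring

lemma IsGradedMap.mem {f : (α → MvPolynomial σ ℂ) →ₗ[MvPolynomial σ ℂ] (β → MvPolynomial σ ℂ)}
    (hf : IsGradedMap degα degβ f) {j : ℤ} {v : α → MvPolynomial σ ℂ} (hv : v ∈ freeGrading degα j) :
    f v ∈ freeGrading degβ j := by
  rw [← freeComponent_of_mem hv, ← freeComponent_map hf]
  exact freeComponent_mem _ _ _

lemma IsGradedMap.exists_lift
    {f : (α → MvPolynomial σ ℂ) →ₗ[MvPolynomial σ ℂ] (β → MvPolynomial σ ℂ)}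
    (hf : IsGradedMap degα degβ f) {j : ℤ} {w : β → MvPolynomial σ ℂ} (hw : w ∈ freeGrading degβ j)
    (h : w ∈ LinearMap.range f) : ∃ v ∈ freeGrading degα j, f v = w := by
  obtain ⟨v, rfl⟩ := h
  exact ⟨_, freeComponent_mem _ _ v, by rw [← freeComponent_map hf, freeComponent_of_mem hw]⟩

lemma exists_sum_freeComponent [Fintype β] (degβ : β → ℤ) (v : β → MvPolynomial σ ℂ) :
    ∃ T : Finset ℤ, v = ∑ j ∈ T, freeComponent degβ j v := by
  classical
  refine ⟨Finset.univ.biUnion fun b => ((DirectSum.decompose (stdGrading σ) (v b)).support).map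
    (addRightEmbedding (degβ b)), ?_⟩
  ext1 b
  rw [Finset.sum_apply]
  conv_lhs => rw [← DirectSum.sum_support_decompose (stdGrading σ) (v b)]
  rw [← Finset.sum_subset (Finset.subset_biUnion_of_mem (fun b =>
    ((DirectSum.decompose (stdGrading σ) (v b)).support).map (addRightEmbedding (degβ b)))
    (Finset.mem_univ b))]
  · rw [Finset.sum_map]
    refine Finset.sum_congr rfl fun j _ => ?_
    simp [freeComponent]
  · intro j _ hj
    by_contra h
    refine hj (Finset.mem_map.2 ⟨j - degβ b, ?_, by simp⟩)
    rw [DFinsupp.mem_support_iff]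
    intro h0
    exact h (by simp [freeComponent, h0])

lemma proj_zero_eq_C (f : MvPolynomial σ ℂ) :
    GradedRing.proj (stdGrading σ) 0 f = C (coeff 0 f) := by
  have h1 : GradedRing.proj (stdGrading σ) 0 f ∈ stdGrading σ 0 := SetLike.coe_mem _
  have h2 : GradedRing.proj (stdGrading σ) 0 f =
      weightedHomogeneousComponent (fun _ : σ => (1 : ℤ)) 0 f :=
    weightedDecomposition.decompose'_apply ..
  ext m
  by_cases hm : m = 0
  · subst hm
    rw [h2, coeff_weightedHomogeneousComponent]
    simp
  · rw [coeff_C, if_neg (Ne.symm hm)]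
    by_contra h
    exact hm ((Finsupp.degree_eq_zero_iff m).1 (by exact_mod_cast mem_stdGrading.1 h1 m h))

lemma coeff_zero_ne_zero_of_notMem {f : MvPolynomial σ ℂ} (h : f ∉ idealOfVars σ ℂ) :
    coeff 0 f ≠ 0 := by
  contrapose! h
  rw [← pow_one (idealOfVars σ ℂ), mem_pow_idealOfVars_iff']
  intro m hm
  rw [(Finsupp.degree_eq_zero_iff m).1 (by lia), h]

/-- A homogeneous submodule of a graded free module has a minimal graded free cover. -/
lemma exists_minimal_cover {n : ℕ} (deg : Fin n → ℤ)
    (Z : Submodule (MvPolynomial σ ℂ) (Fin n → MvPolynomial σ ℂ))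
    (hZ : ∀ v ∈ Z, ∀ j, freeComponent deg j v ∈ Z) :
    ∃ (m : ℕ) (deg' : Fin m → ℤ)
      (f : (Fin m → MvPolynomial σ ℂ) →ₗ[MvPolynomial σ ℂ] (Fin n → MvPolynomial σ ℂ)),
      IsGradedMap deg' deg f ∧ LinearMap.range f = Z ∧
        ∀ v, f v = 0 → ∀ a, v a ∈ idealOfVars σ ℂ := by
  classical
  -- A system of homogeneous generators of least cardinality gives a minimal cover.
  let p : ℕ → Prop := fun m => ∃ (deg' : Fin m → ℤ) (z : Fin m → Fin n → MvPolynomial σ ℂ),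
    (∀ b, z b ∈ freeGrading deg (deg' b)) ∧
      Submodule.span (MvPolynomial σ ℂ) (Set.range z) = Z
  have hp : ∃ m, p m := by
    have hspan : Submodule.span (MvPolynomial σ ℂ) {v | v ∈ Z ∧ ∃ j, v ∈ freeGrading deg j} = Z := by
      refine le_antisymm (Submodule.span_le.2 fun v hv => hv.1) fun v hv => ?_
      obtain ⟨T, hT⟩ := exists_sum_freeComponent deg v
      rw [hT]
      exact sum_mem fun j _ => Submodule.subset_span ⟨hZ v hv j, j, freeComponent_mem _ _ _⟩
    obtain ⟨s, hs, hs'⟩ := (Submodule.fg_span_iff_fg_span_finset_subset _).1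
      (hspan.symm ▸ IsNoetherian.noetherian Z)
    choose! e he using fun v (hv : v ∈ s) => (hs hv).2
    refine ⟨s.card, fun b => e (s.equivFin.symm b), fun b => s.equivFin.symm b,
      fun b => he _ (s.equivFin.symm b).2, ?_⟩
    rw [← hspan, hs']
    congr 1
    ext v
    simp only [Set.mem_range, SetLike.mem_coe]
    exact ⟨fun ⟨b, hb⟩ => hb ▸ (s.equivFin.symm b).2, fun hv => ⟨s.equivFin ⟨v, hv⟩, by simp⟩⟩
  obtain ⟨deg', z, hz, hzZ⟩ := Nat.find_spec hp
  have hmin := fun m => Nat.find_min hp (m := m)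
  generalize Nat.find hp = m at deg' z hz hzZ hmin
  have hf : IsGradedMap deg' deg (Fintype.linearCombination (MvPolynomial σ ℂ) z) := by
    intro a b
    rw [Fintype.linearCombination_apply_single, one_smul]
    exact mem_freeGrading.1 (hz a) b
  refine ⟨m, deg', Fintype.linearCombination (MvPolynomial σ ℂ) z, hf,
    by rw [Fintype.range_linearCombination, hzZ], fun v hv a => ?_⟩
  by_contra ha
  have hw := freeComponent_map hf (deg' a) v
  rw [hv, show freeComponent deg (deg' a) (0 : Fin n → MvPolynomial σ ℂ) = 0 by
    ext1; simp [freeComponent]] at hw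
  have hwa : freeComponent deg' (deg' a) v a = C (coeff 0 (v a)) := by
    simp only [freeComponent, sub_self]
    exact proj_zero_eq_C _
  generalize freeComponent deg' (deg' a) v = w at hw hwa
  obtain _ | m := m
  · exact a.elim0
  -- In the component of the relation in degree `deg' a`, the coefficient of `z a` is a nonzero
  -- scalar, so `z a` can be discarded, contradicting leastness.
  refine hmin m m.lt_succ_self ⟨fun b => deg' (a.succAbove b), fun b => z (a.succAbove b),
    fun b => hz _, ?_⟩
  rw [Fintype.linearCombination_apply, Fin.sum_univ_succAbove _ a, hwa] at hw
  have hza : z a ∈ Submodule.span (MvPolynomial σ ℂ) (Set.range fun b => z (a.succAbove b)) := by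
    have h1 : z a = (C (coeff 0 (v a))⁻¹ : MvPolynomial σ ℂ) •
        -∑ b, w (a.succAbove b) • z (a.succAbove b) := by
      rw [← eq_neg_of_add_eq_zero_left hw.symm, smul_smul, ← map_mul,
        inv_mul_cancel₀ (coeff_zero_ne_zero_of_notMem ha), map_one, one_smul]
    rw [h1]
    exact Submodule.smul_mem _ _ (neg_mem (sum_mem fun b _ =>
      Submodule.smul_mem _ _ (Submodule.subset_span ⟨b, rfl⟩)))
  rw [← hzZ]
  refine le_antisymm (Submodule.span_mono ?_) (Submodule.span_le.2 ?_)
  · rintro _ ⟨b, rfl⟩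
    exact ⟨_, rfl⟩
  · rintro _ ⟨b, rfl⟩
    rcases Fin.eq_self_or_eq_succAbove a b with rfl | ⟨c, rfl⟩
    · exact hza
    · exact Submodule.subset_span ⟨c, rfl⟩

variable (σ) in
/-- A homogeneous submodule of a graded free module of finite rank. -/
structure HomogeneousSubmoduleOfFree where
  rank : ℕ
  deg : Fin rank → ℤ
  Z : Submodule (MvPolynomial σ ℂ) (Fin rank → MvPolynomial σ ℂ)
  homogeneous : ∀ v ∈ Z, ∀ j, freeComponent deg j v ∈ Z

namespace HomogeneousSubmoduleOfFree

variable (Z : HomogeneousSubmoduleOfFree σ)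

/-- The rank of a minimal free cover. -/
noncomputable def coverRank : ℕ := (exists_minimal_cover Z.deg Z.Z Z.homogeneous).choose

/-- The degrees of the generators of a minimal free cover. -/
noncomputable def coverDeg : Fin Z.coverRank → ℤ :=
  (exists_minimal_cover Z.deg Z.Z Z.homogeneous).choose_spec.choose

/-- A minimal free cover. -/
noncomputable def cover :
    (Fin Z.coverRank → MvPolynomial σ ℂ) →ₗ[MvPolynomial σ ℂ] (Fin Z.rank → MvPolynomial σ ℂ) :=
  (exists_minimal_cover Z.deg Z.Z Z.homogeneous).choose_spec.choose_spec.choose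

lemma cover_isGradedMap : IsGradedMap Z.coverDeg Z.deg Z.cover :=
  (exists_minimal_cover Z.deg Z.Z Z.homogeneous).choose_spec.choose_spec.choose_spec.1

lemma range_cover : LinearMap.range Z.cover = Z.Z :=
  (exists_minimal_cover Z.deg Z.Z Z.homogeneous).choose_spec.choose_spec.choose_spec.2.1

lemma cover_minimal : ∀ v, Z.cover v = 0 → ∀ a, v a ∈ idealOfVars σ ℂ :=
  (exists_minimal_cover Z.deg Z.Z Z.homogeneous).choose_spec.choose_spec.choose_spec.2.2

/-- The syzygies of a homogeneous submodule of a graded free module. -/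
noncomputable def syzygy : HomogeneousSubmoduleOfFree σ where
  rank := Z.coverRank
  deg := Z.coverDeg
  Z := LinearMap.ker Z.cover
  homogeneous v hv j := by
    rw [LinearMap.mem_ker] at hv ⊢
    rw [← freeComponent_map Z.cover_isGradedMap, hv]
    ext1
    simp [freeComponent]

/-- The iterated syzygies. -/
noncomputable def iterSyzygy : ℕ → HomogeneousSubmoduleOfFree σ
  | 0 => Z
  | i + 1 => (iterSyzygy i).syzygy

end HomogeneousSubmoduleOfFree

/-- A homogeneous ideal, as a submodule of the free module of rank one. -/
noncomputable def idealAsSubmodule (J : Ideal (MvPolynomial σ ℂ)) (hJ : J.IsHomogeneous (stdGrading σ)) :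
    HomogeneousSubmoduleOfFree σ where
  rank := 1
  deg _ := 0
  Z := Submodule.comap (LinearMap.proj 0) J
  homogeneous _ hv _ := hJ _ hv

/-- `gradedBetti` takes the default value `0` when there is no resolution, so its vanishing has
content for `J` only once iterated minimal covers have produced one. -/
theorem nonempty_minimalGradedFreeResolution (J : Ideal (MvPolynomial σ ℂ))
    (hJ : J.IsHomogeneous (stdGrading σ)) :
    Nonempty (MinimalGradedFreeResolution σ (idealGrading J)) := by
  let Z := (idealAsSubmodule J hJ).iterSyzygy
  let o : Fin (Z 0).rank := (0 : Fin 1)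
  have ho : ∀ a, a = o := fun a => Subsingleton.elim (α := Fin 1) a 0
  have hZ : ∀ v, v ∈ LinearMap.range (Z 0).cover ↔ v o ∈ J := fun v => by
    rw [HomogeneousSubmoduleOfFree.range_cover]
    rfl
  have hcov : ∀ v, (LinearMap.proj o ∘ₗ (Z 0).cover) v ∈ J := fun v =>
    (hZ _).1 (LinearMap.mem_range_self (Z 0).cover v)
  have hker : ∀ v, LinearMap.codRestrict J (LinearMap.proj o ∘ₗ (Z 0).cover) hcov v = 0 ↔
      (Z 0).cover v = 0 := by
    intro v
    rw [← Subtype.coe_inj]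
    refine ⟨fun h => funext fun a => ?_, fun h => ?_⟩
    · rw [ho a]
      exact h
    · exact congrFun h o
  have hex : ∀ i (v : Fin (Z (i + 1)).rank → MvPolynomial σ ℂ),
      (Z i).cover v = 0 ↔ v ∈ LinearMap.range (Z (i + 1)).cover := fun i v => by
    rw [HomogeneousSubmoduleOfFree.range_cover]
    exact LinearMap.mem_ker.symm
  exact ⟨{
    rank := fun i => (Z i).coverRank
    deg := fun i => (Z i).coverDeg
    d := fun i => (Z (i + 1)).cover
    ε := LinearMap.codRestrict J (LinearMap.proj o ∘ₗ (Z 0).cover) hcov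
    d_homogeneous := fun i b a => (Z (i + 1)).cover_isGradedMap b a
    ε_homogeneous := fun a => by
      have := (Z 0).cover_isGradedMap a o
      rwa [show (Z 0).deg o = 0 from rfl, sub_zero] at this
    ε_surjective := fun f => by
      obtain ⟨v, hv⟩ := (hZ fun _ => f).2 f.2
      exact ⟨v, Subtype.ext (congrFun hv o)⟩
    exact_zero := fun v => (hker v).trans (hex 0 v)
    exact_succ := fun i v => hex (i + 1) v
    minimal := fun i v => by
      refine (Z i).cover_minimal _ ?_
      have : (Z (i + 1)).cover v ∈ (Z (i + 1)).Z := by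
        rw [← HomogeneousSubmoduleOfFree.range_cover]
        exact LinearMap.mem_range_self _ v
      exact LinearMap.mem_ker.1 this }⟩

/-- The grading of a homogeneous ideal, inside the polynomial ring. -/
noncomputable def idealPart {σ : Type} (J : Ideal (MvPolynomial σ ℂ)) (j : ℤ) :
    AddSubgroup (MvPolynomial σ ℂ) :=
  (stdGrading σ j).toAddSubgroup ⊓ J.toAddSubgroup

lemma mem_idealPart {σ : Type} {J : Ideal (MvPolynomial σ ℂ)} {j : ℤ} {f : MvPolynomial σ ℂ} :
    f ∈ idealPart J j ↔ f ∈ stdGrading σ j ∧ f ∈ J := Iff.rfl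

namespace MinimalGradedFreeResolution

variable {M : Type*} [AddCommGroup M] [Module (MvPolynomial σ ℂ) M] {𝓜 : ℤ → AddSubgroup M}
  (F : MinimalGradedFreeResolution σ 𝓜)

lemma betti_eq_zero_iff (i : ℕ) (j : ℤ) : F.betti i j = 0 ↔ ∀ a, F.deg i a ≠ j := by
  simp [betti, Finset.filter_eq_empty_iff]

/-- The graded module of boundaries in the `l`-th module of the resolution. -/
noncomputable def boundaries (l : ℕ) (j : ℤ) : AddSubgroup (Fin (F.rank l) → MvPolynomial σ ℂ) :=
  freeGrading (F.deg l) j ⊓ (LinearMap.range (F.d l)).toAddSubgroup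

lemma mem_boundaries {l : ℕ} {j : ℤ} {v : Fin (F.rank l) → MvPolynomial σ ℂ} :
    v ∈ F.boundaries l j ↔ v ∈ freeGrading (F.deg l) j ∧ v ∈ LinearMap.range (F.d l) := Iff.rfl

/-- Koszul homology computes the Betti numbers of the syzygy modules. -/
theorem koszulVanishes_boundaries_iff {ρ : σ → ℕ} (hρ : Function.Injective ρ) (i : ℕ) (j : ℤ) :
    ∀ l m, m = l + 1 + i → (KoszulVanishes ρ (varAct σ _) (F.boundaries l) i j ↔ F.betti m j = 0) := by
  have hgr : ∀ l, IsGradedMap (F.deg (l + 1)) (F.deg l) (F.d l) := fun l => F.d_homogeneous l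
  have hmin : ∀ l v, F.d l v = 0 → ∀ a, v a ∈ idealOfVars σ ℂ := by
    intro l v hv a
    obtain ⟨w, rfl⟩ := (F.exact_succ l v).1 hv
    exact F.minimal _ w a
  have hmap : ∀ l j v, v ∈ freeGrading (F.deg (l + 1)) j → F.d l v ∈ F.boundaries l j :=
    fun l j v hv => ⟨(hgr l).mem hv, ⟨v, rfl⟩⟩
  have hlift : ∀ l j c, c ∈ F.boundaries l j → ∃ v ∈ freeGrading (F.deg (l + 1)) j, F.d l v = c :=
    fun l j c hc => (hgr l).exists_lift hc.1 hc.2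
  induction i with
  | zero =>
    rintro l _ rfl
    rw [koszulVanishes_zero_iff_of_cover hρ (hmap l) (hlift l) (hmin l), F.betti_eq_zero_iff]
  | succ i ih =>
    rintro l m hm
    rw [koszulVanishes_succ_iff_of_cover (𝓩 := F.boundaries (l + 1)) hρ (fun j v => ?_) (hmap l)
      (hlift l) (hmin l), ih (l + 1) m (by lia)]
    rw [mem_boundaries, F.exact_succ l v]
    rfl

/-- Koszul homology computes the Betti numbers of a homogeneous ideal. -/
theorem koszulVanishes_ideal_iff {J : Ideal (MvPolynomial σ ℂ)}
    (F : MinimalGradedFreeResolution σ (idealGrading J)) {ρ : σ → ℕ} (hρ : Function.Injective ρ)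
    (i : ℕ) (j : ℤ) :
    KoszulVanishes ρ (varAct σ _) (idealPart J) i j ↔
      F.betti i j = 0 := by
  let g : (Fin (F.rank 0) → MvPolynomial σ ℂ) →ₗ[MvPolynomial σ ℂ] MvPolynomial σ ℂ :=
    J.subtype ∘ₗ F.ε
  -- The ambient ring is viewed as free of rank one, so that the results on graded maps of free
  -- modules apply.
  let g' : (Fin (F.rank 0) → MvPolynomial σ ℂ) →ₗ[MvPolynomial σ ℂ] (Unit → MvPolynomial σ ℂ) :=
    LinearMap.pi fun _ => g
  have hgr : IsGradedMap (F.deg 0) (fun _ => 0) g' := by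
    intro a b
    rw [sub_zero]
    exact F.ε_homogeneous a
  have hg0 : ∀ v, g v = 0 ↔ F.ε v = 0 := fun v => Submodule.coe_eq_zero
  have hmin : ∀ v, g v = 0 → ∀ a, v a ∈ idealOfVars σ ℂ := by
    intro v hv a
    obtain ⟨w, rfl⟩ := (F.exact_zero v).1 ((hg0 v).1 hv)
    exact F.minimal _ w a
  have hmap : ∀ j v, v ∈ freeGrading (F.deg 0) j →
      g v ∈ idealPart J j := by
    intro j v hv
    have := mem_freeGrading.1 (hgr.mem hv) ()
    rw [sub_zero] at this
    exact ⟨this, (F.ε v).2⟩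
  have hlift : ∀ j c, c ∈ idealPart J j →
      ∃ v ∈ freeGrading (F.deg 0) j, g v = c := by
    rintro j c ⟨hc, hcJ⟩
    obtain ⟨v, hv⟩ := F.ε_surjective ⟨c, hcJ⟩
    obtain ⟨w, hw, h⟩ := hgr.exists_lift (j := j) (w := fun _ => c)
      (mem_freeGrading.2 fun _ => by rwa [sub_zero])
      ⟨v, funext fun _ => congrArg Subtype.val hv⟩
    exact ⟨w, hw, congrFun h ()⟩
  cases i with
  | zero => rw [koszulVanishes_zero_iff_of_cover hρ hmap hlift hmin, F.betti_eq_zero_iff]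
  | succ i =>
    rw [koszulVanishes_succ_iff_of_cover (𝓩 := F.boundaries 0) hρ (fun j v => ?_) hmap hlift hmin,
      F.koszulVanishes_boundaries_iff hρ i j 0 (i + 1) (by lia)]
    rw [mem_boundaries, hg0, F.exact_zero v]
    exact Iff.rfl

end MinimalGradedFreeResolution

/-- Removes the arbitrary choice of resolution in `gradedBetti`. -/
theorem gradedBetti_ideal_eq_zero_iff {J : Ideal (MvPolynomial σ ℂ)}
    (hJ : J.IsHomogeneous (stdGrading σ)) {ρ : σ → ℕ} (hρ : Function.Injective ρ) (i : ℕ) (j : ℤ) :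
    gradedBetti σ (idealGrading J) i j = 0 ↔
      KoszulVanishes ρ (varAct σ _)
        (idealPart J) i j := by
  have h := nonempty_minimalGradedFreeResolution J hJ
  rw [gradedBetti, dif_pos h, h.some.koszulVanishes_ideal_iff hρ]

end Resolution

/-! ### Polynomials in `x` and `y` as polynomials in `y` -/

section Split

variable {σ τ : Type} [Fintype σ] [Fintype τ]

/-- A polynomial in two sets of variables, as a polynomial in the second set. -/
noncomputable def splitEquiv (σ τ : Type) :
    MvPolynomial (σ ⊕ τ) ℂ ≃ₐ[ℂ] MvPolynomial τ (MvPolynomial σ ℂ) :=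
  (renameEquiv ℂ (Equiv.sumComm σ τ)).trans (sumAlgEquiv ℂ τ σ)

@[simp] lemma splitEquiv_C (c : ℂ) : splitEquiv σ τ (C c) = C (C c) := by
  simp [splitEquiv]

@[simp] lemma splitEquiv_X_inl (l : σ) : splitEquiv σ τ (X (Sum.inl l)) = C (X l) := by
  simp [splitEquiv]

@[simp] lemma splitEquiv_X_inr (l : τ) : splitEquiv σ τ (X (Sum.inr l)) = X l := by
  simp [splitEquiv]

lemma coeff_coeff_splitEquiv (f : MvPolynomial (σ ⊕ τ) ℂ) (m : σ →₀ ℕ) (u : τ →₀ ℕ) :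
    coeff m (coeff u (splitEquiv σ τ f)) = coeff (Finsupp.sumElim m u) f := by
  classical
  induction f using MvPolynomial.induction_on generalizing m u with
  | C c =>
    have : 0 = Finsupp.sumElim m u ↔ m = 0 ∧ u = 0 := by
      simp [Finsupp.ext_iff, eq_comm]
    rw [splitEquiv_C, coeff_C, coeff_C, if_congr this rfl rfl]
    by_cases hu : u = 0
    · simp [hu, coeff_C, eq_comm]
    · simp [hu, Ne.symm hu]
  | add p q hp hq => simp [hp, hq]
  | mul_X p s hp =>
    rw [map_mul]
    rcases s with s | s
    · have : Finsupp.sumElim m u - Finsupp.single (Sum.inl s) 1 =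
          Finsupp.sumElim (m - Finsupp.single s 1) u := by
        ext (a | a) <;> simp [Finsupp.single_apply]
      rw [splitEquiv_X_inl, mul_comm, coeff_C_mul, mul_comm, coeff_mul_X', coeff_mul_X', this, hp]
      simp
    · have : Finsupp.sumElim m u - Finsupp.single (Sum.inr s) 1 =
          Finsupp.sumElim m (u - Finsupp.single s 1) := by
        ext (a | a) <;> simp [Finsupp.single_apply]
      rw [splitEquiv_X_inr, coeff_mul_X', coeff_mul_X', this]
      simp [← hp, apply_ite (coeff m)]

lemma degree_sumElim (m : σ →₀ ℕ) (u : τ →₀ ℕ) :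
    (Finsupp.sumElim m u).degree = m.degree + u.degree := by
  simp [Finsupp.degree_eq_sum]

lemma exists_sumElim_eq (d : σ ⊕ τ →₀ ℕ) : ∃ m u, Finsupp.sumElim m u = d :=
  ⟨(Finsupp.sumFinsuppEquivProdFinsupp d).1, (Finsupp.sumFinsuppEquivProdFinsupp d).2, by
    ext (a | a) <;> simp⟩

lemma mem_stdGrading_sum_iff {j : ℤ} {f : MvPolynomial (σ ⊕ τ) ℂ} :
    f ∈ stdGrading (σ ⊕ τ) j ↔ ∀ u, coeff u (splitEquiv σ τ f) ∈ stdGrading σ (j - u.degree) := by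
  simp only [mem_stdGrading, coeff_coeff_splitEquiv]
  constructor
  · intro h u m hm
    have := h _ hm
    rw [degree_sumElim] at this
    lia
  · intro h d hd
    obtain ⟨m, u, rfl⟩ := exists_sumElim_eq d
    have := h _ _ hd
    rw [degree_sumElim]
    lia

lemma coeff_proj {σ : Type} (j : ℤ) (f : MvPolynomial σ ℂ) (m : σ →₀ ℕ) :
    coeff m (GradedRing.proj (stdGrading σ) j f) = if (m.degree : ℤ) = j then coeff m f else 0 := by
  have h2 : GradedRing.proj (stdGrading σ) j f =
      weightedHomogeneousComponent (fun _ : σ => (1 : ℤ)) j f :=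
    weightedDecomposition.decompose'_apply ..
  have : Finsupp.weight (fun _ : σ => (1 : ℤ)) m = (m.degree : ℤ) := by
    simp [Finsupp.weight_apply, Finsupp.sum, Finsupp.degree_apply]
  rw [h2, coeff_weightedHomogeneousComponent, this]

lemma coeff_splitEquiv_proj (j : ℤ) (f : MvPolynomial (σ ⊕ τ) ℂ) (u : τ →₀ ℕ) :
    coeff u (splitEquiv σ τ (GradedRing.proj (stdGrading (σ ⊕ τ)) j f)) =
      GradedRing.proj (stdGrading σ) (j - u.degree) (coeff u (splitEquiv σ τ f)) := by
  ext m
  rw [coeff_coeff_splitEquiv, coeff_proj, coeff_proj, coeff_coeff_splitEquiv, degree_sumElim]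
  congr 1
  rw [eq_sub_iff_add_eq]
  push_cast
  rfl

/-- In lowest order `d` only the constant term of `p` can contribute. This is why the leading
coefficients of elements of `I^d` form a module on which the `y`'s act by zero. -/
lemma coeff_mul_of_mem_pow {A : Type*} [CommRing A] {d : ℕ} {p q : MvPolynomial τ A}
    (hq : q ∈ idealOfVars τ A ^ d) {u : τ →₀ ℕ} (hu : u.degree = d) :
    coeff u (p * q) = coeff 0 p * coeff u q := by
  classical
  rw [coeff_mul, Finset.sum_eq_single (0, u)]
  · rintro ⟨a, b⟩ hab hne
    rw [Finset.HasAntidiagonal.mem_antidiagonal] at hab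
    simp only at hab ⊢
    rw [(mem_pow_idealOfVars_iff' _ _).1 hq b, mul_zero]
    have h1 : a ≠ 0 := by
      rintro rfl
      exact hne (by rw [← hab, zero_add])
    have h2 : a.degree ≠ 0 := fun h => h1 ((Finsupp.degree_eq_zero_iff a).1 h)
    rw [← hu, ← hab, map_add]
    lia
  · intro h
    simp at h

end Split

/-! ### Powers of the linear ideal and ideals defined by leading coefficients -/

section LinearIdeal

variable {n N : ℕ}

lemma linearIdeal_pow_eq_comap (d : ℕ) : linearIdeal n N ^ d =
    (idealOfVars (Fin N) (MvPolynomial (Fin (n + 1)) ℂ) ^ d).comap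
      (splitEquiv (Fin (n + 1)) (Fin N)).toRingEquiv := by
  rw [← Ideal.map_symm, Ideal.map_pow]
  congr 1
  rw [linearIdeal, idealOfVars, Ideal.map_span, ← Set.range_comp]
  congr 2
  ext1 l
  refine (RingEquiv.symm_apply_eq _).2 ?_ |>.symm
  exact (splitEquiv_X_inr l).symm

lemma mem_linearIdeal_pow_iff {d : ℕ} {f : MvPolynomial (Fin (n + 1) ⊕ Fin N) ℂ} :
    f ∈ linearIdeal n N ^ d ↔ splitEquiv (Fin (n + 1)) (Fin N) f ∈
      idealOfVars (Fin N) (MvPolynomial (Fin (n + 1)) ℂ) ^ d := by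
  rw [linearIdeal_pow_eq_comap]
  rfl


lemma coeff_splitEquiv_of_mem {d : ℕ} {f : MvPolynomial (Fin (n + 1) ⊕ Fin N) ℂ}
    (hf : f ∈ linearIdeal n N ^ d) {u : Fin N →₀ ℕ} (hu : u.degree < d) :
    coeff u (splitEquiv _ _ f) = 0 :=
  (mem_pow_idealOfVars_iff' _ _).1 (mem_linearIdeal_pow_iff.1 hf) u hu

lemma linearIdeal_isPrime : (linearIdeal n N).IsPrime := by
  have : linearIdeal n N = RingHom.ker ((constantCoeff (σ := Fin N)).comp
      (splitEquiv (Fin (n + 1)) (Fin N)).toRingEquiv.toRingHom) := by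
    ext f
    rw [← pow_one (linearIdeal n N), mem_linearIdeal_pow_iff, mem_pow_idealOfVars_iff',
      RingHom.mem_ker]
    refine ⟨fun h => h 0 (by simp), fun h u hu => ?_⟩
    rw [(Finsupp.degree_eq_zero_iff u).1 (by lia)]
    exact h
  rw [this]
  exact RingHom.ker_isPrime _

variable {α : Type*}

/-- The coefficients, polynomials in the first set of variables, of given monomials in the second. -/
noncomputable def monomialCoeffs (u : α → Fin N →₀ ℕ) :
    MvPolynomial (Fin (n + 1) ⊕ Fin N) ℂ →+ (α → MvPolynomial (Fin (n + 1)) ℂ) where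
  toFun f a := coeff (u a) (splitEquiv _ _ f)
  map_zero' := by ext1; simp
  map_add' f g := by ext1; simp

lemma monomialCoeffs_apply (u : α → Fin N →₀ ℕ) (f : MvPolynomial (Fin (n + 1) ⊕ Fin N) ℂ) (a : α) :
    monomialCoeffs u f a = coeff (u a) (splitEquiv _ _ f) := rfl

lemma monomialCoeffs_mul {d : ℕ} {u : α → Fin N →₀ ℕ} (hu : ∀ a, (u a).degree = d)
    (g : MvPolynomial (Fin (n + 1) ⊕ Fin N) ℂ) {f : MvPolynomial (Fin (n + 1) ⊕ Fin N) ℂ}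
    (hf : f ∈ linearIdeal n N ^ d) :
    monomialCoeffs u (g * f) = coeff 0 (splitEquiv _ _ g) • monomialCoeffs u f := by
  ext1 a
  rw [monomialCoeffs_apply, map_mul, coeff_mul_of_mem_pow (mem_linearIdeal_pow_iff.1 hf) (hu a)]
  rfl

lemma monomialCoeffs_mem {d : ℕ} {u : α → Fin N →₀ ℕ} (hu : ∀ a, (u a).degree = d) {j : ℤ}
    {f : MvPolynomial (Fin (n + 1) ⊕ Fin N) ℂ} (hf : f ∈ stdGrading _ j) :
    monomialCoeffs u f ∈ freeGrading (fun _ => (d : ℤ)) j := by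
  refine mem_freeGrading.2 fun a => ?_
  rw [← hu a]
  exact mem_stdGrading_sum_iff.1 hf (u a)

lemma exists_monomialCoeffs_eq [Fintype α] {d : ℕ} {u : α → Fin N →₀ ℕ} (hu : ∀ a, (u a).degree = d)
    (hinj : Function.Injective u) {j : ℤ} {v : α → MvPolynomial (Fin (n + 1)) ℂ}
    (hv : v ∈ freeGrading (fun _ => (d : ℤ)) j) :
    ∃ f ∈ stdGrading (Fin (n + 1) ⊕ Fin N) j, f ∈ linearIdeal n N ^ d ∧ monomialCoeffs u f = v := by
  classical
  let f := (splitEquiv (Fin (n + 1)) (Fin N)).symm (∑ a, monomial (u a) (v a))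
  have hf : ∀ w, coeff w (splitEquiv _ _ f) = ∑ a, if u a = w then v a else 0 := fun w => by
    simp [f, coeff_sum, coeff_monomial]
  refine ⟨f, mem_stdGrading_sum_iff.2 fun w => ?_, ?_, ?_⟩
  · rw [hf]
    refine Submodule.sum_mem _ fun a _ => ?_
    split_ifs with h
    · rw [← h, hu a]
      exact mem_freeGrading.1 hv a
    · exact zero_mem _
  · rw [mem_linearIdeal_pow_iff, mem_pow_idealOfVars_iff']
    intro w hw
    rw [hf]
    refine Finset.sum_eq_zero fun a _ => if_neg ?_
    rintro rfl
    rw [hu a] at hw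
    exact lt_irrefl _ hw
  · ext1 a
    rw [monomialCoeffs_apply, hf]
    simp [hinj.eq_iff]

lemma freeComponent_monomialCoeffs {d : ℕ} {u : α → Fin N →₀ ℕ} (hu : ∀ a, (u a).degree = d) (j : ℤ)
    (f : MvPolynomial (Fin (n + 1) ⊕ Fin N) ℂ) :
    monomialCoeffs u (GradedRing.proj (stdGrading _) j f) =
      freeComponent (fun _ => (d : ℤ)) j (monomialCoeffs u f) := by
  ext1 a
  rw [monomialCoeffs_apply, coeff_splitEquiv_proj, hu a]
  rfl

/-- The ideal of those `f` in the `d`-th power of the ideal of the linear subspace whose coefficients at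
given monomials of degree `d` form a vector in `V`. -/
noncomputable def coeffIdeal {d : ℕ} {u : α → Fin N →₀ ℕ} (hu : ∀ a, (u a).degree = d)
    (V : Submodule (MvPolynomial (Fin (n + 1)) ℂ) (α → MvPolynomial (Fin (n + 1)) ℂ)) :
    Ideal (MvPolynomial (Fin (n + 1) ⊕ Fin N) ℂ) where
  carrier := {f | f ∈ linearIdeal n N ^ d ∧ monomialCoeffs u f ∈ V}
  add_mem' hf hg := ⟨add_mem hf.1 hg.1, by rw [map_add]; exact add_mem hf.2 hg.2⟩
  zero_mem' := ⟨zero_mem _, by rw [map_zero]; exact zero_mem _⟩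
  smul_mem' g f hf := ⟨Ideal.mul_mem_left _ _ hf.1, by
    rw [smul_eq_mul, monomialCoeffs_mul hu g hf.1]
    exact V.smul_mem _ hf.2⟩

section CoeffIdeal

variable {d : ℕ} {u : α → Fin N →₀ ℕ} {hu : ∀ a, (u a).degree = d}
  {V : Submodule (MvPolynomial (Fin (n + 1)) ℂ) (α → MvPolynomial (Fin (n + 1)) ℂ)}

lemma mem_coeffIdeal {f : MvPolynomial (Fin (n + 1) ⊕ Fin N) ℂ} :
    f ∈ coeffIdeal hu V ↔ f ∈ linearIdeal n N ^ d ∧ monomialCoeffs u f ∈ V := Iff.rfl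

lemma coeffIdeal_le : coeffIdeal hu V ≤ linearIdeal n N ^ d := fun _ hf => hf.1

lemma linearIdeal_pow_succ_le_coeffIdeal : linearIdeal n N ^ (d + 1) ≤ coeffIdeal hu V := by
  intro f hf
  refine ⟨Ideal.pow_le_pow_right d.le_succ hf, ?_⟩
  have : monomialCoeffs u f = 0 := by
    ext1 a
    exact coeff_splitEquiv_of_mem hf (by rw [hu a]; exact d.lt_succ_self)
  rw [this]
  exact zero_mem _

lemma proj_mem_linearIdeal_pow {f : MvPolynomial (Fin (n + 1) ⊕ Fin N) ℂ}
    (hf : f ∈ linearIdeal n N ^ d) (j : ℤ) :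
    GradedRing.proj (stdGrading _) j f ∈ linearIdeal n N ^ d := by
  rw [mem_linearIdeal_pow_iff, mem_pow_idealOfVars_iff']
  intro w hw
  rw [coeff_splitEquiv_proj, coeff_splitEquiv_of_mem hf hw, map_zero]

lemma linearIdeal_pow_isHomogeneous (d : ℕ) : (linearIdeal n N ^ d).IsHomogeneous (stdGrading _) :=
  fun j _ hf => proj_mem_linearIdeal_pow hf j

lemma coeffIdeal_isHomogeneous (hV : ∀ v ∈ V, ∀ j, freeComponent (fun _ => (d : ℤ)) j v ∈ V) :
    (coeffIdeal hu V).IsHomogeneous (stdGrading _) := by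
  intro j f hf
  refine ⟨proj_mem_linearIdeal_pow hf.1 j, ?_⟩
  have := freeComponent_monomialCoeffs hu j f
  rw [GradedRing.proj_apply] at this
  rw [this]
  exact hV _ hf.2 j

lemma coeffIdeal_top : coeffIdeal (n := n) hu ⊤ = linearIdeal n N ^ d :=
  le_antisymm coeffIdeal_le fun _ hf => ⟨hf, trivial⟩

lemma coeffIdeal_bot (h : ∀ w : Fin N →₀ ℕ, w.degree = d → w ∈ Set.range u) :
    coeffIdeal (n := n) hu ⊥ = linearIdeal n N ^ (d + 1) := by
  refine le_antisymm (fun f hf => ?_) linearIdeal_pow_succ_le_coeffIdeal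
  rw [mem_linearIdeal_pow_iff, mem_pow_idealOfVars_iff']
  intro w hw
  rcases Nat.lt_succ_iff_lt_or_eq.1 hw with hw | hw
  · exact coeff_splitEquiv_of_mem hf.1 hw
  · obtain ⟨a, rfl⟩ := h w hw
    exact congrFun ((Submodule.mem_bot _).1 hf.2) a

/-- The graded pieces of a submodule of `R(-d)^α`. -/
noncomputable def freePart {σ : Type} (d : ℤ) (V : Submodule (MvPolynomial σ ℂ) (α → MvPolynomial σ ℂ))
    (j : ℤ) : AddSubgroup (α → MvPolynomial σ ℂ) :=
  freeGrading (fun _ => d) j ⊓ V.toAddSubgroup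

lemma mem_freePart {σ : Type} {d : ℤ} {V : Submodule (MvPolynomial σ ℂ) (α → MvPolynomial σ ℂ)} {j : ℤ}
    {v : α → MvPolynomial σ ℂ} : v ∈ freePart d V j ↔ v ∈ freeGrading (fun _ => d) j ∧ v ∈ V := Iff.rfl

/-- Extracting coefficients respects the action of the variables only on `I^d`, where the `y`'s
raise the order and hence act by zero; the compatibility in `KoszulExact` is therefore demanded only
on the middle term. -/
lemma koszulExact_coeffIdeal [Fintype α] (hinj : Function.Injective u) :
    KoszulExact (varAct (Fin (n + 1) ⊕ Fin N) (MvPolynomial (Fin (n + 1) ⊕ Fin N) ℂ))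
      (Sum.elim (varAct (Fin (n + 1)) (α → MvPolynomial (Fin (n + 1)) ℂ)) 0)
      (idealPart (coeffIdeal hu ⊥)) (idealPart (coeffIdeal hu V)) (freePart d V)
      (monomialCoeffs u) where
  comm l m p := by simp [mul_left_comm]
  mem_of_mem l j p hp := ⟨X_mul_mem_stdGrading l hp.1, Ideal.mul_mem_left _ _ hp.2⟩
  mem_left j p := by
    rw [mem_idealPart, mem_idealPart, mem_coeffIdeal, mem_coeffIdeal, Submodule.mem_bot]
    refine ⟨fun h => ⟨⟨h.1, h.2.1, ?_⟩, h.2.2⟩, fun h => ⟨h.1.1, h.1.2.1, h.2⟩⟩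
    rw [h.2.2]
    exact zero_mem _
  map_mem j p hp := ⟨monomialCoeffs_mem hu hp.1, hp.2.2⟩
  exists_lift j v hv := by
    obtain ⟨f, hf, hfI, rfl⟩ := exists_monomialCoeffs_eq hu hinj hv.1
    exact ⟨f, ⟨hf, hfI, hv.2⟩, rfl⟩
  map_act l j p hp := by
    rw [varAct_apply, smul_eq_mul, monomialCoeffs_mul hu _ hp.2.1]
    rcases l with l | l <;> simp

variable {ρ : Fin (n + 1) ⊕ Fin N → ℕ}

/-- Over the `x`'s a free module has homology only in homological degree `0` and internal degree
`d`. Over all variables this leaves only `(i + 1, d + i + 1)` with `i + 1 ≤ N`. -/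
lemma koszulVanishes_freePart_top (hρ : Function.Injective ρ)
    (hlt : ∀ l m, ρ (Sum.inl l) < ρ (Sum.inr m)) {i : ℕ} {j : ℤ} (h : N ≤ i ∨ (d : ℤ) + 1 + i < j) :
    KoszulVanishes ρ (Sum.elim (varAct (Fin (n + 1)) (α → MvPolynomial (Fin (n + 1)) ℂ)) 0)
      (freePart d ⊤) (i + 1) j := by
  rw [koszulVanishes_sum_zero_iff hlt]
  intro a b hab hb
  rw [Fintype.card_fin] at hb
  have : freePart (d : ℤ) (⊤ : Submodule (MvPolynomial (Fin (n + 1)) ℂ) (α → _)) =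
      freeGrading (fun _ => (d : ℤ)) := by
    ext j v
    simp [mem_freePart]
  rw [this]
  refine koszulVanishes_freeGrading (hρ.comp Sum.inl_injective) ?_
  by_cases ha : a = 0
  · right
    intro _
    lia
  · exact Or.inl ha

/-- Taking `V = ⊤` exhibits this ideal as the kernel of `I^d → R(-d)^α`; the long exact sequence
then bounds its homology. -/
lemma koszulVanishes_coeffIdeal_bot [Fintype α] (hρ : Function.Injective ρ)
    (hlt : ∀ l m, ρ (Sum.inl l) < ρ (Sum.inr m)) (hinj : Function.Injective u) {i : ℕ} {j : ℤ}
    (h : N ≤ i ∨ (d : ℤ) + 1 + i < j)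
    (hd : KoszulVanishes ρ (varAct _ _) (idealPart (linearIdeal n N ^ d)) i j) :
    KoszulVanishes ρ (varAct _ _) (idealPart (coeffIdeal (n := n) hu ⊥)) i j := by
  have E := koszulExact_coeffIdeal (n := n) (hu := hu) (V := ⊤) hinj
  rw [coeffIdeal_top] at E
  exact E.vanishes_left hρ (fun ω hω hω0 => hd ω (E.chain_of_left hω) hω0)
    (koszulVanishes_freePart_top hρ hlt h)

end CoeffIdeal

/-- Induction on `d`: if `u` lists all monomials of degree `d`, the kernel of `I^d → R(-d)^α` is
`I^(d+1)`. Positivity of `N` is needed at `d = 0`, where the whole ring has `H₀ ≠ 0`. -/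
lemma koszulVanishes_linearIdeal_pow (hN : 0 < N) {ρ : Fin (n + 1) ⊕ Fin N → ℕ}
    (hρ : Function.Injective ρ) (hlt : ∀ l m, ρ (Sum.inl l) < ρ (Sum.inr m)) (d : ℕ) {i : ℕ} {j : ℤ}
    (h : N ≤ i ∨ (d : ℤ) + i < j) :
    KoszulVanishes ρ (varAct _ _) (idealPart (linearIdeal n N ^ d)) i j := by
  induction d with
  | zero =>
    have : idealPart (linearIdeal n N ^ 0) = fun j => (stdGrading _ j).toAddSubgroup := by
      ext j f
      rw [pow_zero, mem_idealPart]
      simp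
    rw [this]
    exact koszulVanishes_polynomial hρ (by lia)
  | succ d ih =>
    let u : Finset.finsuppAntidiag (Finset.univ : Finset (Fin N)) d → Fin N →₀ ℕ := Subtype.val
    have hmem : ∀ w : Fin N →₀ ℕ, w ∈ Finset.finsuppAntidiag Finset.univ d ↔ w.degree = d := by
      intro w
      simp [Finset.mem_finsuppAntidiag, Finsupp.degree_eq_sum]
    have hu : ∀ a, (u a).degree = d := fun a => (hmem _).1 a.2
    rw [← coeffIdeal_bot (hu := hu) fun w hw => ⟨⟨w, (hmem w).2 hw⟩, rfl⟩]
    exact koszulVanishes_coeffIdeal_bot hρ hlt Subtype.val_injective (by push_cast at h; exact h)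
      (ih (by push_cast at h; lia))

end LinearIdeal

/-! ### Nonvanishing for powers of the linear ideal -/

section MainConstruction

variable {n N : ℕ} {ρ : Fin (n + 1) ⊕ Fin N → ℕ}

/-- The Koszul boundary of `y₀ ^ m e_{s₀}`, with `s₀` consisting of `i + 1` of the `y`'s, is a
nonzero cycle with coefficients in `I^(m+1)`. It bounds nothing there, since an `(i + 1)`-chain of
this internal degree has coefficients of degree `m`. -/
lemma not_koszulVanishes_linearIdeal_pow_succ (hρ : Function.Injective ρ) (m : ℕ) {i : ℕ}
    (hi : i < N) :
    ¬ KoszulVanishes ρ (varAct _ _) (idealPart (linearIdeal n N ^ (m + 1))) i (m + 1 + i) := by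
  classical
  let y₀ : Fin (n + 1) ⊕ Fin N := Sum.inr ⟨0, by lia⟩
  let s₀ : Finset (Fin (n + 1) ⊕ Fin N) :=
    (Finset.univ : Finset (Fin (i + 1))).map
      ⟨fun a => Sum.inr (Fin.castLE hi a), fun a b h => by simpa using h⟩
  have hs₀ : s₀.card = i + 1 := by simp [s₀]
  have hy₀ : y₀ ∈ s₀ := Finset.mem_map.2 ⟨0, Finset.mem_univ _, rfl⟩
  have hI : ∀ l ∈ s₀, X l ∈ linearIdeal n N := by
    intro l hl
    obtain ⟨a, -, rfl⟩ := Finset.mem_map.1 hl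
    exact Ideal.subset_span ⟨_, rfl⟩
  let η : Finset (Fin (n + 1) ⊕ Fin N) → MvPolynomial (Fin (n + 1) ⊕ Fin N) ℂ :=
    fun s => if s = s₀ then X y₀ ^ m else 0
  have hη : IsKoszulChain (fun j => (stdGrading (Fin (n + 1) ⊕ Fin N) j).toAddSubgroup) (i + 1)
      (m + 1 + i) η := by
    refine fun s => ⟨?_, fun h => if_neg ?_⟩
    · dsimp only [η]
      split_ifs
      · have := (isWeightedHomogeneous_X ℂ (fun _ : Fin (n + 1) ⊕ Fin N => (1 : ℤ)) y₀).pow m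
        rw [show (m : ℤ) + 1 + i - (i + 1 : ℕ) = m • (1 : ℤ) by simp; ring]
        exact this
      · exact zero_mem _
    · rintro rfl
      exact h hs₀
  have hz := hη.diff ρ (x := varAct _ _) fun l j p hp => X_mul_mem_stdGrading l hp
  have hzI : ∀ s, koszulDiff ρ (varAct _ _) η s ∈ linearIdeal n N ^ (m + 1) := by
    intro s
    rw [koszulDiff_apply]
    refine sum_mem fun l _ => zsmul_mem ?_ _
    dsimp only [η]
    split_ifs with h'
    · rw [varAct_apply, smul_eq_mul, pow_succ']
      exact Ideal.mul_mem_mul (hI l (h' ▸ Finset.mem_insert_self l s))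
        (Ideal.pow_mem_pow (hI _ hy₀) m)
    · rw [map_zero]
      exact zero_mem _
  intro H
  obtain ⟨ξ, hξ, h⟩ := H (koszulDiff ρ (varAct _ _) η)
    (fun s => ⟨⟨(hz s).1, hzI s⟩, (hz s).2⟩)
    (koszulDiff_koszulDiff hρ (fun l m p => by simp [mul_left_comm]) η)
  -- A nonzero element of `I^(m+1)` cannot have degree `m`.
  have hξ0 : ξ = 0 := by
    ext1 s
    obtain ⟨h1, h2⟩ := (hξ s).1
    ext d
    by_contra hd
    obtain ⟨a, w, rfl⟩ := exists_sumElim_eq d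
    have h3 := mem_stdGrading.1 h1 _ hd
    rw [degree_sumElim] at h3
    rw [← coeff_coeff_splitEquiv, coeff_splitEquiv_of_mem h2 (by push_cast at h3; lia)] at hd
    exact hd rfl
  rw [hξ0, map_zero] at h
  have h1 := congrFun h (s₀.erase y₀)
  rw [koszulDiff_apply, Finset.sum_eq_single y₀] at h1
  · rw [Finset.insert_erase hy₀] at h1
    have h2 : koszulSign ρ y₀ (s₀.erase y₀) ≠ 0 := by simp [koszulSign]
    have h3 : varAct _ _ y₀ (η s₀) ≠ 0 := by simp [η]
    exact smul_ne_zero h2 h3 h1.symm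
  · intro l _ hl
    have : η (insert l (s₀.erase y₀)) = 0 := if_neg fun h' => by
      rw [← h', Finset.mem_insert] at hy₀
      rcases hy₀ with h | h
      · exact hl h.symm
      · exact Finset.notMem_erase _ _ h
    rw [this, map_zero, smul_zero]
  · simp

end MainConstruction

/-! ### Choice of monomials, order of the variables, and the embedding of `F₀` -/

lemma MinimalGradedFreeResolution.finsum_betti {σ : Type} [Fintype σ] [DecidableEq σ] {M : Type*}
    [AddCommGroup M] [Module (MvPolynomial σ ℂ) M] {𝓜 : ℤ → AddSubgroup M}
    (F : MinimalGradedFreeResolution σ 𝓜) (i : ℕ) : ∑ᶠ j : ℤ, F.betti i j = F.rank i := by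
  classical
  rw [finsum_eq_sum_of_support_subset (s := Finset.univ.image (F.deg i))]
  · simp only [betti]
    rw [← Finset.card_eq_sum_card_image, Finset.card_univ, Fintype.card_fin]
  · intro j hj
    rw [Function.mem_support, ne_eq, F.betti_eq_zero_iff] at hj
    push Not at hj
    obtain ⟨a, ha⟩ := hj
    simpa using ⟨a, ha⟩

/-- A family of `b` different monomials of degree `k` in `N` variables. -/
lemma exists_injective_degree_eq {N k b : ℕ} (h : b ≤ (k + N - 1).choose k) :
    ∃ u : Fin b → Fin N →₀ ℕ, Function.Injective u ∧ ∀ a, (u a).degree = k := by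
  have hc : Fintype.card (Fin b) ≤
      Fintype.card (Finset.finsuppAntidiag (Finset.univ : Finset (Fin N)) k) := by
    rw [Fintype.card_fin, Fintype.card_coe, Finset.card_finsuppAntidiag_nat_eq_choose]
    simpa [add_comm] using h
  obtain ⟨e⟩ := Function.Embedding.nonempty_of_card_le hc
  refine ⟨fun a => (e a : Fin N →₀ ℕ), Subtype.val_injective.comp e.injective, fun a => ?_⟩
  have := (Finset.mem_finsuppAntidiag.1 (e a).2).1
  rw [Finsupp.degree_eq_sum]
  exact this

/-- The variables of the ambient space, those of the linear subspace coming first. -/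
def ambientOrder (n N : ℕ) : Fin (n + 1) ⊕ Fin N → ℕ :=
  Sum.elim (fun l => l) (fun m => n + 1 + m)

lemma ambientOrder_injective (n N : ℕ) : Function.Injective (ambientOrder n N) := by
  rintro (a | a) (b | b) h <;> simp only [ambientOrder, Sum.elim_inl, Sum.elim_inr] at h
  · rw [Fin.ext h]
  · lia
  · lia
  · rw [Fin.ext (Nat.add_left_cancel h)]

lemma ambientOrder_lt (n N : ℕ) (l : Fin (n + 1)) (m : Fin N) :
    ambientOrder n N (Sum.inl l) < ambientOrder n N (Sum.inr m) := by
  simp only [ambientOrder, Sum.elim_inl, Sum.elim_inr]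
  lia

/-- A graded free module with generators in degrees at least `k` embeds into one of the same rank with
all generators in degree `k`. -/
lemma exists_gradedMap_injective {n b : ℕ} (deg : Fin b → ℤ) {k : ℤ} (hk : ∀ a, k ≤ deg a) :
    ∃ D : (Fin b → MvPolynomial (Fin (n + 1)) ℂ) →ₗ[MvPolynomial (Fin (n + 1)) ℂ]
      (Fin b → MvPolynomial (Fin (n + 1)) ℂ),
      Function.Injective D ∧ IsGradedMap deg (fun _ => k) D := by
  let D : (Fin b → MvPolynomial (Fin (n + 1)) ℂ) →ₗ[MvPolynomial (Fin (n + 1)) ℂ]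
      (Fin b → MvPolynomial (Fin (n + 1)) ℂ) :=
    LinearMap.pi fun a => (X 0 ^ (deg a - k).toNat : MvPolynomial (Fin (n + 1)) ℂ) •
      LinearMap.proj a
  have hD : ∀ v a, D v a = X 0 ^ (deg a - k).toNat * v a := fun v a => rfl
  refine ⟨D, fun v w h => ?_, fun a c => ?_⟩
  · ext1 a
    have := congrFun h a
    rw [hD, hD] at this
    exact mul_left_cancel₀ (pow_ne_zero _ (X_ne_zero _)) this
  · rw [hD]
    by_cases hac : c = a
    · subst hac
      have h1 := (isWeightedHomogeneous_X ℂ (fun _ : Fin (n + 1) => (1 : ℤ)) 0).pow (deg c - k).toNat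
      have h2 : (deg c - k).toNat • (1 : ℤ) = deg c - k := by
        have := hk c
        simp
        lia
      rw [Pi.single_eq_same, mul_one]
      rwa [h2] at h1
    · rw [Pi.single_eq_of_ne hac, mul_zero]
      exact zero_mem _

/-! ### The ideal attached to a resolution -/

section Construction

variable {n N k : ℕ} {M : Type*} [AddCommGroup M] [Module (MvPolynomial (Fin (n + 1)) ℂ) M]
  {𝓜 : ℤ → AddSubgroup M} (F : MinimalGradedFreeResolution (Fin (n + 1)) 𝓜)
  {D : (Fin (F.rank 0) → MvPolynomial (Fin (n + 1)) ℂ) →ₗ[MvPolynomial (Fin (n + 1)) ℂ]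
    (Fin (F.rank 0) → MvPolynomial (Fin (n + 1)) ℂ)}

lemma freePart_range_comp (hDgr : IsGradedMap (F.deg 0) (fun _ => (k : ℤ)) D) :
    freePart (k : ℤ) (LinearMap.range (D ∘ₗ F.d 0)) =
      fun j => (F.boundaries 0 j).map D.toAddMonoidHom := by
  have hdgr : IsGradedMap (F.deg 1) (F.deg 0) (F.d 0) := F.d_homogeneous 0
  ext j w
  rw [mem_freePart, AddSubgroup.mem_map]
  constructor
  · rintro ⟨hw, v, rfl⟩
    refine ⟨F.d 0 (freeComponent (F.deg 1) j v), ⟨hdgr.mem (freeComponent_mem _ _ _), _, rfl⟩, ?_⟩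
    rw [← freeComponent_map hdgr]
    change D _ = _
    rw [← freeComponent_map hDgr]
    exact freeComponent_of_mem hw
  · rintro ⟨_, ⟨hw, v, rfl⟩, rfl⟩
    exact ⟨hDgr.mem hw, v, rfl⟩

/-- Injectivity of `D` makes this module isomorphic to the first syzygy module of `M`, which
accounts for the shift `a + 1`; the index `b` counts the exterior factors from the `y`'s. -/
lemma koszulVanishes_freePart_iff {ρ : Fin (n + 1) ⊕ Fin N → ℕ} (hρ : Function.Injective ρ)
    (hlt : ∀ l m, ρ (Sum.inl l) < ρ (Sum.inr m)) (hDinj : Function.Injective D)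
    (hDgr : IsGradedMap (F.deg 0) (fun _ => (k : ℤ)) D) (i : ℕ) (j : ℤ) :
    KoszulVanishes ρ (Sum.elim (varAct _ _) 0)
        (freePart (k : ℤ) (LinearMap.range (D ∘ₗ F.d 0))) i j ↔
      ∀ a b, a + b = i → b ≤ N → F.betti (a + 1) (j - b) = 0 := by
  rw [koszulVanishes_sum_zero_iff hlt, Fintype.card_fin, freePart_range_comp F hDgr]
  refine forall₂_congr fun a b => forall₂_congr fun _ _ => ?_
  rw [koszulVanishes_map_iff (x := varAct _ _) hDinj (fun l p => D.map_smul _ p),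
    F.koszulVanishes_boundaries_iff (hρ.comp Sum.inl_injective) _ _ 0 (a + 1) (by lia)]

/-- The Betti numbers of the ideal attached to a module, in the range where the powers of the ideal of
the linear subspace do not contribute. -/
theorem exists_ideal_of_resolution (hN : 0 < N) (hk : ∀ a, k ≤ F.deg 0 a)
    (hgen : F.rank 0 ≤ (k + N - 1).choose k) :
    ∃ J : Ideal (MvPolynomial (Fin (n + 1) ⊕ Fin N) ℂ), J.IsHomogeneous (stdGrading _) ∧
      J ≤ linearIdeal n N ^ k ∧ linearIdeal n N ^ (k + 1) ≤ J ∧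
      (∀ i j, (N ≤ i ∨ (k : ℤ) + 1 + i < j) →
        (∀ a b, a + b = i → b ≤ N → F.betti (a + 1) (j - b) = 0) →
        gradedBetti (Fin (n + 1) ⊕ Fin N) (idealGrading J) i j = 0) ∧
      (∀ a b j, (k : ℤ) + (a + b : ℕ) < j → b ≤ N → F.betti (a + 1) (j - b) ≠ 0 →
        gradedBetti (Fin (n + 1) ⊕ Fin N) (idealGrading J) (a + b) j ≠ 0) := by
  have hρ := ambientOrder_injective n N
  have hlt := ambientOrder_lt n N
  generalize ambientOrder n N = ρ at hρ hlt
  obtain ⟨u, hinj, hu⟩ := exists_injective_degree_eq hgen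
  obtain ⟨D, hDinj, hDgr⟩ := exists_gradedMap_injective (n := n) (F.deg 0) hk
  have hdgr : IsGradedMap (F.deg 1) (F.deg 0) (F.d 0) := F.d_homogeneous 0
  have hquot := koszulVanishes_freePart_iff F hρ hlt hDinj hDgr
  have hV : ∀ v ∈ LinearMap.range (D ∘ₗ F.d 0), ∀ j,
      freeComponent (fun _ => (k : ℤ)) j v ∈ LinearMap.range (D ∘ₗ F.d 0) := by
    rintro _ ⟨v, rfl⟩ j
    refine ⟨freeComponent (F.deg 1) j v, ?_⟩
    rw [LinearMap.comp_apply, LinearMap.comp_apply, freeComponent_map hDgr, freeComponent_map hdgr]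
  generalize LinearMap.range (D ∘ₗ F.d 0) = V at hquot hV
  have hbot : ∀ i j, (N ≤ i ∨ (k : ℤ) + 1 + i < j) →
      KoszulVanishes ρ (varAct _ _) (idealPart (coeffIdeal (n := n) hu ⊥)) i j := fun i j h =>
    koszulVanishes_coeffIdeal_bot hρ hlt hinj h
      (koszulVanishes_linearIdeal_pow hN hρ hlt k (by lia))
  have E := koszulExact_coeffIdeal (n := n) (hu := hu) (V := V) hinj
  have hbetti := gradedBetti_ideal_eq_zero_iff (coeffIdeal_isHomogeneous (hu := hu) hV) hρ
  -- For `i > 0` the obstruction lies in homological degree `i - 1` of the kernel, which vanishes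
  -- for `j > k + 1 + (i - 1)`; this explains the bound `k + i`.
  have hright : ∀ (i : ℕ) (j : ℤ), (k : ℤ) + i < j →
      KoszulVanishes ρ (varAct _ _) (idealPart (coeffIdeal hu V)) i j →
      KoszulVanishes ρ (Sum.elim (varAct _ _) 0) (freePart (k : ℤ) V) i j := by
    intro i j hj h
    cases i with
    | zero => exact E.vanishes_right_zero h
    | succ i => exact E.vanishes_right hρ (hbot i j (Or.inr (by push_cast at hj; lia))) h
  refine ⟨coeffIdeal hu V, coeffIdeal_isHomogeneous hV, coeffIdeal_le,
    linearIdeal_pow_succ_le_coeffIdeal, fun i j h h' => ?_, fun a b j hj hb h h0 => ?_⟩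
  · exact (hbetti i j).2 (E.vanishes_mid hρ (hbot i j h) ((hquot i j).2 h'))
  · exact h ((hquot (a + b) j).1 (hright _ _ hj ((hbetti _ _).1 h0)) a b rfl hb)

end Construction

/-! ### Support, regularity, positivity of degrees, and the theorem -/

lemma radical_eq_linearIdeal {n N k m : ℕ} (hk : k ≠ 0)
    {J : Ideal (MvPolynomial (Fin (n + 1) ⊕ Fin N) ℂ)} (h1 : J ≤ linearIdeal n N ^ k)
    (h2 : linearIdeal n N ^ m ≤ J) : J.radical = linearIdeal n N := by
  have hI := linearIdeal_isPrime (n := n) (N := N)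
  refine le_antisymm (hI.radical_le_iff.2 (h1.trans (Ideal.pow_le_self hk))) fun f hf => ?_
  exact ⟨m, h2 (Ideal.pow_mem_pow hf m)⟩

/-- Strictly increasing maximal degrees make the regularity appear at the end of the resolution. -/
lemma HasMaximalDegreeSequence.regularity_eq {σ : Type} {M : Type*} [AddCommGroup M]
    [Module (MvPolynomial σ ℂ) M] {𝓜 : ℤ → AddSubgroup M} {ℓ : ℕ} {t : Fin ℓ → ℤ}
    (h : HasMaximalDegreeSequence σ 𝓜 t) (ht : StrictMono t) (i : Fin ℓ) (hi : (i : ℕ) + 1 = ℓ) :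
    regularity σ 𝓜 = t i - i := by
  have hmono : ∀ d : ℕ, ∀ a b : Fin ℓ, (a : ℕ) + d = b → t a + d ≤ t b := by
    intro d
    induction d with
    | zero =>
      intro a b hab
      rw [Fin.ext (show (a : ℕ) = b from hab)]
      simp
    | succ d ih =>
      intro a b hab
      -- Strictly increasing integers grow by at least one per step, so `tᵢ - i` is nondecreasing
      -- and largest at the end.
      have h1 := ih a ⟨a + d, by lia⟩ rfl
      have h2 := ht (show (⟨a + d, by lia⟩ : Fin ℓ) < b from Fin.lt_def.2 (by dsimp only; lia))
      push_cast
      lia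
  refine IsGreatest.csSup_eq ⟨⟨i, t i, (h.1 i).1, rfl⟩, ?_⟩
  rintro _ ⟨a, j, hj, rfl⟩
  by_cases ha : a < ℓ
  · have h1 := (h.1 ⟨a, ha⟩).2 hj
    have h2 := hmono (i - a) ⟨a, ha⟩ i (by dsimp only; lia)
    lia
  · exact absurd (h.2 a (by lia) j) hj

lemma strictMono_append_succ {r N : ℕ} {t : Fin (r + 1) → ℤ} (ht : StrictMono t) :
    StrictMono (Fin.append (fun i : Fin r => t i.succ)
      (fun j : Fin N => t (Fin.last r) + ((j : ℤ) + 1))) := by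
  intro a b
  refine Fin.addCases (fun a => ?_) (fun a => ?_) a <;>
    refine Fin.addCases (fun b => ?_) (fun b => ?_) b <;> intro h
  · rw [Fin.append_left, Fin.append_left]
    exact ht (Fin.succ_lt_succ_iff.2 h)
  · rw [Fin.append_left, Fin.append_right]
    have := ht.monotone (Fin.le_last a.succ)
    lia
  · rw [Fin.lt_def] at h
    simp at h
    lia
  · rw [Fin.append_right, Fin.append_right]
    have : a < b := by simpa using h
    have : (a : ℤ) < b := by exact_mod_cast this
    lia

/-- The minimal generators of a graded module generated in positive degrees have positive degree. -/
lemma MinimalGradedFreeResolution.deg_pos {σ : Type} [Fintype σ] [DecidableEq σ] {M : Type*}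
    [AddCommGroup M] [Module (MvPolynomial σ ℂ) M] {𝓜 : ℤ → AddSubgroup M}
    [DirectSum.Decomposition 𝓜] [SetLike.GradedSMul (stdGrading σ) 𝓜]
    (F : MinimalGradedFreeResolution σ 𝓜)
    (hpos : Submodule.span (MvPolynomial σ ℂ) (⋃ j > (0 : ℤ), (𝓜 j : Set M)) = ⊤)
    (a : Fin (F.rank 0)) : 0 < F.deg 0 a := by
  by_contra! ha
  have hε : ∀ j v, v ∈ freeGrading (F.deg 0) j → F.ε v ∈ 𝓜 j := by
    intro j v hv
    rw [linearMap_apply_eq_sum F.ε v]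
    refine sum_mem fun b _ => ?_
    have := SetLike.GradedSMul.smul_mem (mem_freeGrading.1 hv b) (F.ε_homogeneous b)
    rwa [vadd_eq_add, sub_add_cancel] at this
  let W : Submodule (MvPolynomial σ ℂ) M :=
    (Submodule.comap (LinearMap.proj a) (idealOfVars σ ℂ)).map F.ε
  -- If the generator `a` had degree at most `0`, every element of positive degree would lift with
  -- `a`-th coordinate of positive degree. Such elements generate `M`, so the generator `a` would be
  -- superfluous.
  have hW : ∀ m, m ∈ W := by
    rw [← Submodule.eq_top_iff', eq_top_iff, ← hpos, Submodule.span_le]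
    intro m hm
    simp only [Set.mem_iUnion] at hm
    obtain ⟨j, hj, hm⟩ := hm
    obtain ⟨v, rfl⟩ := F.ε_surjective m
    obtain ⟨T, hT⟩ := exists_sum_freeComponent (F.deg 0) v
    -- Only the component of `v` in the degree `j` of its image is needed.
    have h1 : F.ε v = ∑ i ∈ T, if i = j then F.ε (freeComponent (F.deg 0) i v) else 0 := by
      rw [← DirectSum.decompose_of_mem_same 𝓜 hm]
      conv_lhs => rw [hT]
      rw [map_sum, DirectSum.decompose_sum, DFinsupp.finsetSum_apply, AddSubgroup.val_finsetSum]
      refine Finset.sum_congr rfl fun i _ => ?_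
      have h2 := hε i _ (freeComponent_mem (F.deg 0) i v)
      split_ifs with h
      · rw [← h, DirectSum.decompose_of_mem_same 𝓜 h2]
      · exact DirectSum.decompose_of_mem_ne 𝓜 h2 h
    rw [h1]
    refine sum_mem fun i _ => ?_
    split_ifs with h
    · refine ⟨_, ?_, rfl⟩
      have h3 := mem_freeGrading.1 (freeComponent_mem (F.deg 0) i v) a
      change freeComponent (F.deg 0) i v a ∈ idealOfVars σ ℂ
      rw [← pow_one (idealOfVars σ ℂ), mem_pow_idealOfVars_iff']
      intro d hd
      by_contra h4
      have := mem_stdGrading.1 h3 d h4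
      lia
    · exact zero_mem _
  obtain ⟨v, hv, hva⟩ := hW (F.ε (Pi.single a 1))
  obtain ⟨w, hw⟩ := (F.exact_zero (Pi.single a 1 - v)).1 (by rw [map_sub, hva, sub_self])
  have h1 := F.minimal 0 w a
  rw [hw, Pi.sub_apply, Pi.single_eq_same] at h1
  have h2 := add_mem h1 hv
  rw [LinearMap.proj_apply, sub_add_cancel, ← pow_one (idealOfVars σ ℂ), mem_pow_idealOfVars_iff']
    at h2
  simpa using h2 0 (by simp)

/-- The maximal degree sequence of a power of the ideal of a linear subspace. -/
lemma gradedBetti_linearIdeal_pow_succ {n N : ℕ} (hN : 0 < N) (m : ℕ) :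
    (∀ i j, (N ≤ i ∨ (m : ℤ) + 1 + i < j) →
      gradedBetti (Fin (n + 1) ⊕ Fin N) (idealGrading (linearIdeal n N ^ (m + 1))) i j = 0) ∧
    (∀ i : ℕ, i < N →
      gradedBetti (Fin (n + 1) ⊕ Fin N) (idealGrading (linearIdeal n N ^ (m + 1))) i
        (m + 1 + i) ≠ 0) := by
  have hρ := ambientOrder_injective n N
  have hbetti := gradedBetti_ideal_eq_zero_iff (linearIdeal_pow_isHomogeneous (n := n) (N := N) (m + 1)) hρ
  refine ⟨fun i j h => (hbetti i j).2 (koszulVanishes_linearIdeal_pow hN hρ (ambientOrder_lt n N) _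
    (by push_cast; exact h)), fun i hi h => ?_⟩
  exact not_koszulVanishes_linearIdeal_pow_succ hρ m hi ((hbetti _ _).1 h)

theorem theorem1p3 (n N r k : ℕ) {M : Type*} [AddCommGroup M]
    [Module (MvPolynomial (Fin (n + 1)) ℂ) M] [Module.Finite (MvPolynomial (Fin (n + 1)) ℂ) M]
    (𝓜 : ℤ → AddSubgroup M) [DirectSum.Decomposition 𝓜]
    [SetLike.GradedSMul (stdGrading (Fin (n + 1))) 𝓜]
    (hpos : Submodule.span (MvPolynomial (Fin (n + 1)) ℂ) (⋃ j > (0 : ℤ), (𝓜 j : Set M)) = ⊤)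
    (t : Fin (r + 1) → ℤ) (ht : HasMaximalDegreeSequence (Fin (n + 1)) 𝓜 t)
    (hmono : StrictMono t) (hr : r ≤ n + 1)
    (hk : IsLeast {j : ℤ | gradedBetti (Fin (n + 1)) 𝓜 0 j ≠ 0} (k : ℤ))
    (hgen : ∑ᶠ j : ℤ, gradedBetti (Fin (n + 1)) 𝓜 0 j ≤ (k + N - 1).choose k) :
    ∃ J : Ideal (MvPolynomial (Fin (n + 1) ⊕ Fin N) ℂ),
      J.IsHomogeneous (stdGrading (Fin (n + 1) ⊕ Fin N)) ∧
      J.radical = linearIdeal n N ∧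
      J ≤ linearIdeal n N ^ k ∧
      ((1 ≤ r ∨ t 0 = k) → linearIdeal n N ^ (k + 1) ≤ J) ∧
      HasMaximalDegreeSequence (Fin (n + 1) ⊕ Fin N) (idealGrading J)
        (Fin.append (fun i : Fin r => t i.succ)
          (fun j : Fin N => t (Fin.last r) + ((j : ℤ) + 1))) ∧
      regularity (Fin (n + 1) ⊕ Fin N) (idealGrading J) =
        regularity (Fin (n + 1)) 𝓜 + 1 := by
  have hF : Nonempty (MinimalGradedFreeResolution (Fin (n + 1)) 𝓜) := by
    -- Without a resolution all Betti numbers would be `0` by default, contradicting the existence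
    -- of `k`.
    by_contra h
    exact hk.1 (dif_neg h)
  obtain ⟨F, hFβ⟩ : ∃ F : MinimalGradedFreeResolution (Fin (n + 1)) 𝓜,
      ∀ i j, gradedBetti (Fin (n + 1)) 𝓜 i j = F.betti i j :=
    ⟨hF.some, fun i j => by rw [gradedBetti, dif_pos hF]⟩
  have hk0 : k ≠ 0 := by
    rintro rfl
    obtain ⟨h, -⟩ := hk
    rw [Set.mem_ofPred_eq, hFβ, ne_eq, F.betti_eq_zero_iff] at h
    push Not at h
    obtain ⟨a, ha⟩ := h
    exact (F.deg_pos hpos a).ne' ha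
  have hdeg : ∀ a, (k : ℤ) ≤ F.deg 0 a := by
    refine fun a => hk.2 ?_
    rw [Set.mem_ofPred_eq, hFβ, ne_eq, F.betti_eq_zero_iff]
    exact fun h => h a rfl
  have hrank : F.rank 0 ≤ (k + N - 1).choose k := by
    simpa only [hFβ, F.finsum_betti] using hgen
  have hN : 0 < N := by
    rw [Nat.pos_iff_ne_zero]
    rintro rfl
    -- For `N = 0` the bound is `(k - 1).choose k = 0`, as `k ≠ 0`, whereas `F₀` has a generator of
    -- degree `k`.
    rw [Nat.choose_eq_zero_of_lt (by lia), Nat.le_zero] at hrank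
    have h := hk.1
    rw [Set.mem_ofPred_eq, hFβ, ne_eq, F.betti_eq_zero_iff] at h
    exact h fun a => (Fin.cast hrank a).elim0
  have hkt : (k : ℤ) ≤ t 0 := hk.2 (ht.1 0).1
  have hreg : ∀ J : Ideal (MvPolynomial (Fin (n + 1) ⊕ Fin N) ℂ),
      HasMaximalDegreeSequence (Fin (n + 1) ⊕ Fin N) (idealGrading J)
        (Fin.append (fun i : Fin r => t i.succ)
          (fun j : Fin N => t (Fin.last r) + ((j : ℤ) + 1))) →
      regularity (Fin (n + 1) ⊕ Fin N) (idealGrading J) = regularity (Fin (n + 1)) 𝓜 + 1 := by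
    intro J hJ
    rw [hJ.regularity_eq (strictMono_append_succ hmono) (Fin.natAdd r ⟨N - 1, by lia⟩)
      (by rw [Fin.val_natAdd]; dsimp only; lia), ht.regularity_eq hmono (Fin.last r) (by simp),
      Fin.append_right, Fin.val_natAdd, Fin.val_last]
    dsimp only
    push_cast [Nat.cast_sub (show 1 ≤ N from hN)]
    ring
  suffices H : ∃ J : Ideal (MvPolynomial (Fin (n + 1) ⊕ Fin N) ℂ),
      J.IsHomogeneous (stdGrading (Fin (n + 1) ⊕ Fin N)) ∧ J ≤ linearIdeal n N ^ k ∧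
      (∃ m, linearIdeal n N ^ m ≤ J) ∧
      ((1 ≤ r ∨ t 0 = k) → linearIdeal n N ^ (k + 1) ≤ J) ∧
      HasMaximalDegreeSequence (Fin (n + 1) ⊕ Fin N) (idealGrading J)
        (Fin.append (fun i : Fin r => t i.succ)
          (fun j : Fin N => t (Fin.last r) + ((j : ℤ) + 1))) by
    obtain ⟨J, h1, h2, ⟨m, h3⟩, h4, h5⟩ := H
    exact ⟨J, h1, radical_eq_linearIdeal hk0 h2 h3, h2, h4, h5, hreg J h5⟩
  obtain _ | r := r
  · obtain ⟨m, hm⟩ : ∃ m : ℕ, t 0 = m := ⟨(t 0).toNat, by lia⟩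
    obtain ⟨h1, h2⟩ := gradedBetti_linearIdeal_pow_succ (n := n) hN m
    -- `M` is free: the power `t₀ + 1` has top degrees `t₀ + 1, …, t₀ + N`. It contains `I^(k+1)`
    -- when `t₀ = k`.
    refine ⟨linearIdeal n N ^ (m + 1), linearIdeal_pow_isHomogeneous _,
      Ideal.pow_le_pow_right (by lia), ⟨m + 1, le_rfl⟩, fun h => ?_, ?_, fun i hi j => h1 i j (by lia)⟩
    · rw [show k = m by lia]
    · refine Fin.addCases (fun i => i.elim0) fun i => ?_
      rw [Fin.append_right, Fin.val_natAdd, Nat.zero_add, show Fin.last 0 = 0 from rfl, hm]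
      refine ⟨?_, fun j hj => ?_⟩
      · rw [show (m : ℤ) + ((i : ℕ) + 1) = m + 1 + (i : ℕ) by ring]
        exact h2 i i.2
      · by_contra hlt
        exact hj (h1 _ _ (by lia))
  -- From here the last index is `r + 1`. The sequence is extended by `0` so that indices can be
  -- natural numbers; only values up to `r + 1` are used.
  · let T : ℕ → ℤ := fun a => if h : a < r + 1 + 1 then t ⟨a, h⟩ else 0
    have hT : ∀ a : Fin (r + 1 + 1), t a = T a := fun a => by
      dsimp only [T]
      rw [dif_pos a.2]
    have hTs : ∀ a (h : a < r + 1 + 1), t ⟨a, h⟩ = T a := fun a h => hT ⟨a, h⟩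
    clear_value T
    have hTmono : ∀ d a, a + d ≤ r + 1 → T a + d ≤ T (a + d) := by
      intro d
      induction d with
      | zero => simp
      | succ d ih =>
        intro a ha
        have h1 := ih a (by lia)
        have h2 := hmono (show (⟨a + d, by lia⟩ : Fin (r + 1 + 1)) < ⟨a + (d + 1), by lia⟩ from
          Fin.lt_def.2 (by dsimp only; lia))
        rw [hTs, hTs] at h2
        push_cast
        lia
    have hle : ∀ a j, a ≤ r + 1 → T a < j → F.betti a j = 0 := by
      intro a j ha hj
      by_contra h
      rw [← hFβ] at h
      have := (ht.1 ⟨a, by lia⟩).2 h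
      rw [hTs] at this
      exact absurd hj (not_lt.2 this)
    have hne : ∀ a, a ≤ r + 1 → F.betti a (T a) ≠ 0 := by
      intro a ha
      have := (ht.1 ⟨a, by lia⟩).1
      rwa [hTs, Set.mem_ofPred_eq, hFβ] at this
    have hlast : ∀ a j, r + 1 < a → F.betti a j = 0 := by
      intro a j ha
      rw [← hFβ]
      exact ht.2 a (by lia) j
    have hkT : (k : ℤ) ≤ T 0 := by
      have := hT 0
      rw [Fin.val_zero] at this
      rwa [← this]
    obtain ⟨J, hJ, h1, h2, hz, hnz⟩ := exists_ideal_of_resolution F hN hdeg hrank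
    refine ⟨J, hJ, h1, ⟨_, h2⟩, fun _ => h2, ?_, fun i hi j => ?_⟩
    · refine Fin.addCases (fun i => ?_) (fun c => ?_)
      · rw [Fin.append_left, Fin.val_castAdd, hT, Fin.val_succ]
        have hi := i.2
        generalize (i : ℕ) = i at hi ⊢
        have h0 := hTmono (i + 1) 0 (by lia)
        rw [Nat.zero_add] at h0
        push_cast at h0
        -- The maximum is attained with no exterior factor; each such factor adds only one to the
        -- degree, and `t` grows at least as fast.
        refine ⟨hnz i 0 _ (by lia) (by lia) (by simpa using hne (i + 1) (by lia)), fun j hj => ?_⟩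
        by_contra! hlt
        refine hj (hz i j (by lia) fun a b hab hb => hle _ _ (by lia) ?_)
        have := hTmono b (a + 1) (by lia)
        rw [show a + 1 + b = i + 1 by lia] at this
        lia
      · rw [Fin.append_right, Fin.val_natAdd, hT, Fin.val_last]
        have hc := c.2
        generalize (c : ℕ) = c at hc ⊢
        have h0 := hTmono (r + 1) 0 (by lia)
        rw [Nat.zero_add] at h0
        push_cast at h0
        refine ⟨?_, fun j hj => ?_⟩
        -- The last syzygies of `M` together with `c + 1` exterior factors attain the maximum.
        · have := hnz r (c + 1) (T (r + 1) + ((c : ℕ) + 1)) (by push_cast; lia) (by lia) (by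
            simpa using hne (r + 1) le_rfl)
          rwa [show r + ((c : ℕ) + 1) = r + 1 + c by ring] at this
        · by_contra! hlt
          refine hj (hz _ j (by push_cast; lia) fun a b hab hb => ?_)
          by_cases ha : a ≤ r
          · have := hTmono (r - a) (a + 1) (by lia)
            rw [show a + 1 + (r - a) = r + 1 by lia] at this
            exact hle _ _ (by lia) (by lia)
          · exact hlast _ _ (by lia)
    -- Beyond `r + 1 + N`, at most `N` exterior factors force `a + 1 > r + 1`.
    · exact hz i j (by lia) fun a b hab hb => hlast _ _ (by lia)
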